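/- Let $n\ge 0$ and let $\mathfrak b$ be a Borel subalgebra (a maximal solvable subalgebra) of $\mathfrak{sl}(n+1,\mathbb C)$. An ideal of $\mathfrak b$ is called ad-nilpotent if all of its elements are ad-nilpotent in $\mathfrak{sl}(n+1,\mathbb C)$; the class of nilpotence of such an ideal $\mathfrak i$ is the smallest $m\ge 0$ such that $\mathfrak i^{m+1}=0$, where $\mathfrak i^{1}=\mathfrak i$ and $\mathfrak i^{r+1}=[\mathfrak i,\mathfrak i^{r}]$ (so the zero ideal has class $0$). Then $\mathfrak b$ has only finitely many ad-nilpotent ideals. Let $\alpha_n(h,k)$ be the number of those of dimension $h$ and class of nilpotence $k$, and put $$C_n(q,t)=\sum_{h,k\ge 0}\alpha_n(h,k)\,t^hq^k\in\mathbb Z[q,t].$$ For integers $m\ge r\ge 0$ let $\left[{m\atop r}\right]_t=\frac{[m]!}{[m-r]!\,[r]!}$, where $[m]!=[m][m-1]\cdots[1]$, $[0]!=1$ and $[i]=(t^i-1)/(t-1)$. (a) One has $$C_n(q,t)=\sum_{k=0}^n\left(\sum_{0=i_0<i_1<\dots<i_k<i_{k+1}=n+1}\ \prod_{j=0}^{k-1}t^{\,i_{j+1}(i_{j+3}-i_{j+2})}\left[{i_{j+2}-i_j-1\atop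 i_{j+1}-i_j}\right]_t\right)q^k,$$ where $i_{k+2}=n+2$. Consider the Dyck paths from $(0,0)$ to $(2n+2,0)$, i.e. the lattice paths with steps $(1,1)$ and $(1,-1)$ that do not pass below the $x$-axis. The height $\operatorname{ht}(P)$ of such a path $P$ is the maximal ordinate of its peaks, and $A(P)$ is the (Euclidean) area of the region between $P$ and the $x$-axis. (b) $C_n(q,1)$ is the generating function of these paths with respect to height minus one: $q\,C_n(q,1)=\sum_P q^{\operatorname{ht}(P)}$. (c) For every such path $P$ the number $\frac{(n+1)^2}{2}-\frac{A(P)}{2}$ is a nonnegative integer, and $$C_n(1,t)=\sum_P t^{\,(n+1)^2/2-A(P)/2}.$$ -/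

import Mathlib

open Polynomial

attribute [local instance] LieRing.ofAssociativeRing

noncomputable section

namespace QTCatalan

/-! ### Ad-nilpotent ideals of a Borel subalgebra of `sl(n+1, ℂ)` -/

/-- The Lie algebra `sl(n+1, ℂ)` of traceless `(n+1) × (n+1)` matrices. -/
abbrev SL (n : ℕ) : Type :=
  LieAlgebra.SpecialLinear.sl (Fin (n + 1)) ℂ

/-- A Borel subalgebra of a Lie algebra: a maximal solvable subalgebra. -/
def IsBorel {L : Type*} [LieRing L] [LieAlgebra ℂ L] (b : LieSubalgebra ℂ L) : Prop :=
  Maximal (fun c : LieSubalgebra ℂ L => LieAlgebra.IsSolvable c) b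

/-- The set of ideals of `b` all of whose elements are ad-nilpotent in `sl(n+1, ℂ)`. -/
def adNilpotentIdeals {n : ℕ} (b : LieSubalgebra ℂ (SL n)) : Set (LieIdeal ℂ b) :=
  {I | ∀ x ∈ I, IsNilpotent (LieAlgebra.ad ℂ (SL n) (x : SL n))}

/-- The class of nilpotence of an ideal `I`: the smallest `m` such that the term of index `m` of
the lower central series `I, [I, I], [I, [I, I]], …` (indexed from `0`) vanishes.
The zero ideal has class `0`, a nonzero abelian ideal has class `1`. -/
def nilpotenceClass {n : ℕ} {b : LieSubalgebra ℂ (SL n)} (I : LieIdeal ℂ b) : ℕ :=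
  LieModule.nilpotencyLength I I

/-- The number of ad-nilpotent ideals of `b` with dimension `h` and class of nilpotence `k`. -/
def idealCount {n : ℕ} (b : LieSubalgebra ℂ (SL n)) (h k : ℕ) : ℕ :=
  Set.ncard {I | I ∈ adNilpotentIdeals b ∧ Module.finrank ℂ I = h ∧ nilpotenceClass I = k}

/-- The `(q,t)`-Catalan number `∑_{h,k} α(h,k) t^h q^k`, where `α(h,k)` is the number of
ad-nilpotent ideals of dimension `h` and class of nilpotence `k`, as an element of `ℤ[t][q]`:
the outer variable is `q`, the inner one `t`. -/
def qtCatalan {n : ℕ} (b : LieSubalgebra ℂ (SL n)) : ℤ[X][X] :=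
  ∑ᶠ p : ℕ × ℕ, (idealCount b p.1 p.2 : ℤ[X][X]) * C (X ^ p.1) * X ^ p.2

/-! ### `t`-binomial coefficients -/

/-- The `t`-integer `[i] = (t^i - 1)/(t - 1) = 1 + t + ⋯ + t^(i-1)`. -/
def tInt (i : ℕ) : ℤ[X] := ∑ l ∈ Finset.range i, X ^ l

/-- The `t`-factorial `[m]! = [m][m-1]⋯[1]`. -/
def tFactorial (m : ℕ) : ℤ[X] := ∏ i ∈ Finset.range m, tInt (i + 1)

/-- The `t`-binomial coefficient `[m]! / ([m-r]! [r]!)`, and `0` if `r > m`. The division by the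
monic polynomial `[m-r]! [r]!` is exact, see `tBinom_mul`. -/
def tBinom (m r : ℕ) : ℤ[X] :=
  if r ≤ m then tFactorial m /ₘ (tFactorial (m - r) * tFactorial r) else 0

theorem tInt_mul (i : ℕ) : tInt i * (X - 1) = X ^ i - 1 := geom_sum_mul X i

theorem tInt_monic (i : ℕ) : (tInt (i + 1)).Monic := by
  unfold tInt
  exact Polynomial.monic_geom_sum_X i.succ_ne_zero

theorem tFactorial_monic (m : ℕ) : (tFactorial m).Monic :=
  Polynomial.monic_prod_of_monic _ _ fun i _ => tInt_monic i

theorem tFactorial_succ (m : ℕ) : tFactorial (m + 1) = tFactorial m * tInt (m + 1) := by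
  unfold tFactorial
  exact Finset.prod_range_succ _ m

theorem tInt_add (a b : ℕ) : tInt (a + b) = tInt a + X ^ a * tInt b := by
  unfold tInt
  rw [Finset.sum_range_add, Finset.mul_sum]
  simp only [pow_add]

theorem tFactorial_dvd (a : ℕ) : ∀ b, tFactorial a * tFactorial b ∣ tFactorial (a + b) := by
  induction a with
  | zero => intro b; simp [tFactorial]
  | succ a iha =>
    intro b
    induction b with
    | zero => simp [tFactorial]
    | succ b ihb =>
      obtain ⟨u, hu⟩ := iha (b + 1)
      obtain ⟨v, hv⟩ := ihb
      refine ⟨u + X ^ (a + 1) * v, ?_⟩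
      have e1 : a + (b + 1) = a + 1 + b := by ring
      have e2 : tInt (a + 1 + b + 1) = tInt (a + 1) + X ^ (a + 1) * tInt (b + 1) := by
        rw [add_assoc (a + 1), tInt_add]
      rw [e1] at hu
      rw [← add_assoc (a + 1), tFactorial_succ, e2, mul_add]
      nth_rewrite 1 [hu]
      rw [hv, tFactorial_succ a, tFactorial_succ b]
      ring

theorem tBinom_mul {m r : ℕ} (h : r ≤ m) :
    (tFactorial (m - r) * tFactorial r) * tBinom m r = tFactorial m := by
  rw [tBinom, if_pos h]
  have hd := tFactorial_dvd (m - r) r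
  rw [Nat.sub_add_cancel h] at hd
  have h0 := (Polynomial.modByMonic_eq_zero_iff_dvd
    ((tFactorial_monic (m - r)).mul (tFactorial_monic r))).2 hd
  have h1 := Polynomial.modByMonic_add_div (tFactorial m)
    (tFactorial (m - r) * tFactorial r)
  rwa [h0, zero_add] at h1

/-! ### Sequences of indices -/

open Classical in
/-- The sequences `0 = i_0 < i_1 < ⋯ < i_k < i_{k+1} = n + 1`, extended by `i_{k+2} = n + 2`. -/
def indexSeqs (n k : ℕ) : Finset (Fin (k + 3) → Fin (n + 3)) :=
  {i | StrictMono i ∧ (i ⟨0, by omega⟩ : ℕ) = 0 ∧ (i ⟨k + 1, by omega⟩ : ℕ) = n + 1 ∧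
    (i ⟨k + 2, by omega⟩ : ℕ) = n + 2}

/-- The product
`∏_{j=0}^{k-1} t^(i_{j+1} (i_{j+3} - i_{j+2})) [i_{j+2} - i_j - 1 choose i_{j+1} - i_j]_t`.
The subtractions are never truncated for an increasing sequence. -/
def seqWeight {n k : ℕ} (i : Fin (k + 3) → Fin (n + 3)) : ℤ[X] :=
  ∏ j : Fin k,
    X ^ ((i ⟨j + 1, by omega⟩ : ℕ) * ((i ⟨j + 3, by omega⟩ : ℕ) - (i ⟨j + 2, by omega⟩ : ℕ))) *
      tBinom ((i ⟨j + 2, by omega⟩ : ℕ) - (i ⟨j, by omega⟩ : ℕ) - 1)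
        ((i ⟨j + 1, by omega⟩ : ℕ) - (i ⟨j, by omega⟩ : ℕ))

/-! ### Dyck paths -/

/-- The Dyck paths from `(0,0)` to `(2m,0)`. -/
abbrev DyckPath (m : ℕ) : Type := {p : DyckWord // p.semilength = m}

/-- The ordinate of a Dyck path after `j` steps: the number of up-steps minus the number of
down-steps among them (nonnegative, by definition of a Dyck path). -/
def ordinate (p : DyckWord) (j : ℕ) : ℕ :=
  (p.toList.take j).count DyckStep.U - (p.toList.take j).count DyckStep.D

/-- The height of a Dyck path: the maximal ordinate of a peak, a peak being the point between an
up-step and an immediately following down-step. -/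
def height (p : DyckWord) : ℕ :=
  ({j ∈ Finset.range p.toList.length |
      p.toList[j]? = some DyckStep.U ∧ p.toList[j + 1]? = some DyckStep.D} : Finset ℕ).sup
    fun j => ordinate p (j + 1)

/-- The Euclidean area of the region between a Dyck path (with steps `(1,1)` and `(1,-1)`) and the
`x`-axis: the sum of the areas of the trapezoids of width `1` below the steps. -/
def area (p : DyckWord) : ℚ :=
  ∑ j ∈ Finset.range p.toList.length, ((ordinate p j : ℚ) + ordinate p (j + 1)) / 2

end QTCatalan

end

namespace QTCatalan

/-! ### Identities for `t`-binomial coefficients -/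

/-! Everything is transported to the monotone sequences `g` with `g 0 = 0` and `g j < j` for `0 < j
≤ n + 1` (`boundedSeqs`).

By Lie's theorem and maximality, a Borel subalgebra is, after a change of basis, the algebra of
traceless upper triangular matrices. Its ad-nilpotent ideals are those with zero diagonal.
Bracketing with diagonal elements isolates single entries, so such an ideal is spanned by matrix
units. Bracketing with matrix units shows that their positions are closed under moving up and to the
right. The ideal is thus given by the number `g (j + 1)` of rows filled in column `j`. Its dimension
is the sum of `g`. The term of index `k` of its lower central series is described in the same way by
`g^[k + 1]`, so its class is the least `k` with `g^[k + 1] (n + 1) = 0`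
(`exists_ideal_parametrization`).

For (a), sort the sequences by the orbit `n + 1 > g (n + 1) > ⋯ > 0`, read backwards as a chain `s`
with `g (s (j + 1)) = s j`. Strictly between `s (j + 1)` and `s (j + 2)` the terms of `g` form an
arbitrary monotone sequence in `[s j, s (j + 1)]`, counted by a `t`-binomial coefficient
(`seqGF_succ`, `sum_chains_eq_seqGF`). The powers of `t` agree with the stated ones after a
telescoping rearrangement (`sum_exponents`).

For (b), let `F k` be the series of Dyck paths of height at most `k`. The first-return decomposition
gives `F (k + 1) = 1 / (1 - x F k)`. Expanding powers of this by the binomial series yields the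
recursion of `seqGF` at `t = 1` (`sum_eval_seqGF`).

For (c), let `g j` be the number of down-steps before the `j`-th up-step. Then the sum of `g` is the
number of pairs of a down-step and a later up-step, and each such pair lowers the area by 2 from its
maximum `(n + 1)^2` (`area_eq`, `sum_dyckPath_coarea`). -/

theorem tFactorial_zero : tFactorial 0 = 1 := by simp [tFactorial]

theorem tBinom_add_mul (a r : ℕ) :
    tFactorial a * tFactorial r * tBinom (a + r) r = tFactorial (a + r) := by
  have := tBinom_mul (Nat.le_add_left r a)
  rwa [Nat.add_sub_cancel] at this

theorem tBinom_zero_right (m : ℕ) : tBinom m 0 = 1 := by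
  have := tBinom_add_mul m 0
  rw [tFactorial_zero, mul_one] at this
  exact mul_left_cancel₀ (tFactorial_monic m).ne_zero (this.trans (mul_one _).symm)

theorem tBinom_self (m : ℕ) : tBinom m m = 1 := by
  have := tBinom_add_mul 0 m
  rw [tFactorial_zero, one_mul, zero_add] at this
  exact mul_left_cancel₀ (tFactorial_monic m).ne_zero (this.trans (mul_one _).symm)

theorem tBinom_eq_zero {m r : ℕ} (h : m < r) : tBinom m r = 0 := by
  rw [tBinom, if_neg (by omega)]

/-- The `t`-analogue of Pascal's rule. -/
theorem tBinom_succ_succ (m r : ℕ) :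
    tBinom (m + 1) (r + 1) = tBinom m r + X ^ (r + 1) * tBinom m (r + 1) := by
  rcases lt_trichotomy m r with h | rfl | h
  · rw [tBinom_eq_zero h, tBinom_eq_zero (by omega), tBinom_eq_zero (by omega)]; simp
  · rw [tBinom_self, tBinom_self, tBinom_eq_zero (by omega)]; simp
  · obtain ⟨a, rfl⟩ := Nat.exists_eq_add_of_lt h
    have h1 := tBinom_add_mul (a + 1) (r + 1)
    have h2 := tBinom_add_mul (a + 1) r
    have h3 := tBinom_add_mul a (r + 1)
    have e1 : a + 1 + (r + 1) = r + a + 1 + 1 := by ring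
    have e2 : a + 1 + r = r + a + 1 := by ring
    have e3 : a + (r + 1) = r + a + 1 := by ring
    have e4 : r + a + 1 + 1 = (r + 1) + (a + 1) := by ring
    rw [e1] at h1
    rw [e2] at h2
    rw [e3] at h3
    refine mul_left_cancel₀
      ((tFactorial_monic (a + 1)).mul (tFactorial_monic (r + 1))).ne_zero ?_
    have h4 : tFactorial (r + a + 1 + 1)
        = tFactorial (r + a + 1) * (tInt (r + 1) + X ^ (r + 1) * tInt (a + 1)) := by
      rw [tFactorial_succ, e4, tInt_add]
    rw [h1, h4, mul_add, mul_add]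
    nth_rewrite 1 [← h2]
    rw [← h3, tFactorial_succ a, tFactorial_succ r]
    ring

/-- The `t`-analogue of the hockey-stick identity: Pascal's rule iterated. It performs the summation
over the last term of a monotone sequence. -/
theorem sum_X_pow_mul_tBinom (p r : ℕ) :
    ∑ i ∈ Finset.range (r + 1), X ^ i * tBinom (p + i) i = tBinom (p + 1 + r) r := by
  induction r with
  | zero => simp [tBinom_zero_right]
  | succ r ih =>
    rw [Finset.sum_range_succ, ih, ← add_assoc (p + 1) r 1, tBinom_succ_succ]
    congr 3
    ring

theorem eval_one_tBinom (m r : ℕ) : (tBinom m r).eval 1 = m.choose r := by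
  induction m generalizing r with
  | zero =>
    cases r with
    | zero => simp [tBinom_zero_right]
    | succ r => simp [tBinom_eq_zero]
  | succ m ih =>
    cases r with
    | zero => simp [tBinom_zero_right]
    | succ r => simp [tBinom_succ_succ, ih, Nat.choose_succ_succ]

/-! ### Monotone sequences below the diagonal -/

open Classical in
/-- The monotone sequences `g(0) ≤ g(1) ≤ ⋯ ≤ g(u) ≤ d` with `g(0) = 0` and `g(j) < j` for
`0 < j ≤ u`, extended by `0`. -/
noncomputable def boundedSeqs : ℕ → ℕ → Finset (ℕ → ℕ)
  | 0, _ => {0}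
  | u + 1, d => (Finset.range (min d u + 1)).biUnion fun e =>
      (boundedSeqs u e).image fun g => Function.update g (u + 1) e

/-- At `j = 0` the truncated bound `j - 1` is `0`, so the single inequality `g j ≤ j - 1` encodes
both `g 0 = 0` and `g j < j`. -/
theorem mem_boundedSeqs {u d : ℕ} {g : ℕ → ℕ} :
    g ∈ boundedSeqs u d ↔ (∀ j, u < j → g j = 0) ∧ (∀ j ≤ u, g j ≤ j - 1) ∧
      (∀ i j, i ≤ j → j ≤ u → g i ≤ g j) ∧ g u ≤ d := by
  induction u generalizing d g with
  | zero =>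
    simp only [boundedSeqs, Finset.mem_singleton]
    constructor
    · rintro rfl; simp
    · rintro ⟨h1, h2, -⟩
      funext j
      rcases Nat.eq_zero_or_pos j with rfl | hj
      · simpa using h2 0 le_rfl
      · exact h1 j hj
  | succ u ih =>
    simp only [boundedSeqs, Finset.mem_biUnion, Finset.mem_image, Finset.mem_range, ih]
    constructor
    · rintro ⟨e, he, g, ⟨h1, h2, h3, h4⟩, rfl⟩
      refine ⟨fun j hj => ?_, fun j hj => ?_, fun i j hij hj => ?_, ?_⟩
      · rw [Function.update_of_ne (by omega)]; exact h1 j (by omega)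
      · rcases Nat.lt_or_ge u j with h | h
        · obtain rfl : j = u + 1 := by omega
          rw [Function.update_self]; omega
        · rw [Function.update_of_ne (by omega)]; exact h2 j h
      · rcases Nat.lt_or_ge u j with h | h
        · obtain rfl : j = u + 1 := by omega
          rw [Function.update_self]
          rcases Nat.lt_or_ge u i with h' | h'
          · obtain rfl : i = u + 1 := by omega
            rw [Function.update_self]
          · rw [Function.update_of_ne (by omega)]
            exact (h3 i u h' le_rfl).trans h4
        · rw [Function.update_of_ne (by omega), Function.update_of_ne (by omega)]
          exact h3 i j hij h
      · rw [Function.update_self]; omega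
    · rintro ⟨h1, h2, h3, h4⟩
      have := h2 (u + 1) le_rfl
      refine ⟨g (u + 1), by omega, Function.update g (u + 1) 0,
        ⟨fun j hj => ?_, fun j hj => ?_, fun i j hij hj => ?_, ?_⟩, ?_⟩
      · by_cases h : j = u + 1
        · subst h; simp
        · rw [Function.update_of_ne h]; exact h1 j (by omega)
      · rw [Function.update_of_ne (by omega)]; exact h2 j (by omega)
      · rw [Function.update_of_ne (by omega), Function.update_of_ne (by omega)]
        exact h3 i j hij (by omega)
      · rw [Function.update_of_ne (by omega)]; exact h3 u (u + 1) (by omega) le_rfl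
      · simp

theorem boundedSeqs_apply_zero {u d : ℕ} {g : ℕ → ℕ} (hg : g ∈ boundedSeqs u d) : g 0 = 0 := by
  have := (mem_boundedSeqs.1 hg).2.1 0 (Nat.zero_le _)
  omega

theorem sum_boundedSeqs_succ {M : Type*} [AddCommMonoid M] (u d : ℕ) (w : (ℕ → ℕ) → M) :
    ∑ g ∈ boundedSeqs (u + 1) d, w g =
      ∑ e ∈ Finset.range (min d u + 1), ∑ g ∈ boundedSeqs u e,
        w (Function.update g (u + 1) e) := by
  classical
  rw [boundedSeqs, Finset.sum_biUnion]
  · refine Finset.sum_congr rfl fun e _ => ?_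
    rw [Finset.sum_image]
    intro g hg g' hg' h
    have h1 := (mem_boundedSeqs.1 hg).1 (u + 1) (by omega)
    have h2 := (mem_boundedSeqs.1 hg').1 (u + 1) (by omega)
    funext j
    by_cases hj : j = u + 1
    · rw [hj, h1, h2]
    · have := congrFun h j
      simpa [Function.update_of_ne hj] using this
  · intro e _ e' _ hne
    rw [Function.onFun, Finset.disjoint_left]
    intro g hg hg'
    obtain ⟨a, -, rfl⟩ := Finset.mem_image.1 hg
    obtain ⟨a', -, h⟩ := Finset.mem_image.1 hg'
    have := congrFun h (u + 1)
    simp only [Function.update_self] at this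
    exact hne this.symm

/-- The sum `g(0) + ⋯ + g(u)`. -/
def total (u : ℕ) (g : ℕ → ℕ) : ℕ := ∑ j ∈ Finset.range (u + 1), g j

theorem total_congr {u : ℕ} {g g' : ℕ → ℕ} (h : ∀ j ≤ u, g j = g' j) : total u g = total u g' :=
  Finset.sum_congr rfl fun j hj => h j (by simpa [Nat.lt_succ_iff] using hj)

theorem total_update (u e : ℕ) (g : ℕ → ℕ) :
    total (u + 1) (Function.update g (u + 1) e) = total u g + e := by
  rw [total, Finset.sum_range_succ, Function.update_self]
  congr 1
  exact total_congr fun j hj => Function.update_of_ne (by omega) _ _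

/-- The sequence `g` with the terms beyond `g(m)` replaced by `0`. -/
def trunc (m : ℕ) (g : ℕ → ℕ) (j : ℕ) : ℕ := if j ≤ m then g j else 0

theorem trunc_update {m u : ℕ} (h : m ≤ u) (e : ℕ) (g : ℕ → ℕ) :
    trunc m (Function.update g (u + 1) e) = trunc m g := by
  funext j
  unfold trunc
  split_ifs with hj
  · exact Function.update_of_ne (by omega) _ _
  · rfl

theorem trunc_eq_self {m d : ℕ} {g : ℕ → ℕ} (hg : g ∈ boundedSeqs m d) : trunc m g = g := by
  funext j
  unfold trunc
  split_ifs with hj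
  · rfl
  · exact ((mem_boundedSeqs.1 hg).1 j (by omega)).symm

theorem boundedSeqs_filter {m d e : ℕ} (h : e ≤ d) :
    {g ∈ boundedSeqs m d | g m ≤ e} = boundedSeqs m e := by
  ext g
  simp only [Finset.mem_filter, mem_boundedSeqs]
  grind

theorem sum_shifted (l d p : ℕ) (h : l ≤ d) :
    ∑ e ∈ Finset.range (d + 1), (if l ≤ e then
      X ^ e * (X ^ (l * p) * tBinom (p + e - l) (e - l)) else 0) =
      X ^ (l * (p + 1)) * tBinom (p + 1 + d - l) (d - l) := by
  obtain ⟨r, rfl⟩ := Nat.exists_eq_add_of_le h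
  rw [add_assoc, Finset.sum_range_add, Finset.sum_eq_zero, zero_add]
  · have e1 : p + 1 + (l + r) - l = p + 1 + r := by omega
    rw [Nat.add_sub_cancel_left, e1, ← sum_X_pow_mul_tBinom, Finset.mul_sum]
    refine Finset.sum_congr rfl fun i _ => ?_
    have e2 : p + (l + i) - l = p + i := by omega
    rw [if_pos (by omega), Nat.add_sub_cancel_left, e2]
    ring
  · intro e he
    rw [if_neg (by simpa using he)]

/-- The sum over all monotone extensions of a sequence by `p` terms at most `d`. -/
theorem sum_boundedSeqs_add (m p d : ℕ) (hd : d ≤ m) (w : (ℕ → ℕ) → ℤ[X]) :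
    ∑ g ∈ boundedSeqs (m + p) d, w (trunc m g) * X ^ total (m + p) g =
      ∑ h ∈ boundedSeqs m d, w h * X ^ total m h *
        (X ^ (h m * p) * tBinom (p + d - h m) (d - h m)) := by
  induction p generalizing d with
  | zero =>
    refine Finset.sum_congr rfl fun g hg => ?_
    rw [trunc_eq_self hg]
    simp [tBinom_self]
  | succ p ih =>
    -- Since `d ≤ m`, the diagonal bound is automatic for all terms beyond `g m`; only monotonicity
    -- and the bound `d` constrain them.
    rw [← add_assoc, sum_boundedSeqs_succ, min_eq_left (by omega)]
    have : ∀ e ∈ Finset.range (d + 1), ∑ g ∈ boundedSeqs (m + p) e,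
        w (trunc m (Function.update g (m + p + 1) e)) *
          X ^ total (m + p + 1) (Function.update g (m + p + 1) e) =
        ∑ h ∈ boundedSeqs m d, w h * X ^ total m h * (if h m ≤ e then
          X ^ e * (X ^ (h m * p) * tBinom (p + e - h m) (e - h m)) else 0) := by
      intro e he
      have he' : e ≤ d := by simpa [Nat.lt_succ_iff] using he
      simp only [trunc_update (Nat.le_add_right m p), total_update, pow_add _ _ e, ← mul_assoc]
      rw [← Finset.sum_mul, ih e (he'.trans hd), ← boundedSeqs_filter he', Finset.sum_filter,
        Finset.sum_mul]
      refine Finset.sum_congr rfl fun h _ => ?_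
      split_ifs
      · ring
      · ring
    rw [Finset.sum_congr rfl this, Finset.sum_comm]
    refine Finset.sum_congr rfl fun h hh => ?_
    rw [← Finset.mul_sum, sum_shifted _ _ _ (mem_boundedSeqs.1 hh).2.2.2]

/-! ### Iterates of a sequence and the recursion for their generating function -/

/-- The number of steps, minus one, in which the iterates of `g` lead from `N` to `0`. -/
noncomputable def descents (g : ℕ → ℕ) (N : ℕ) : ℕ := sInf {k | g^[k + 1] N = 0}

theorem descents_eq_zero {g : ℕ → ℕ} {N : ℕ} (h : g N = 0) : descents g N = 0 :=
  Nat.sInf_eq_zero.2 (Or.inl h)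

theorem iterate_add_le {g : ℕ → ℕ} {N : ℕ} (h : ∀ j ≤ N, g j ≤ j - 1) (k : ℕ) :
    g^[k] N ≤ N - k := by
  induction k with
  | zero => simp
  | succ k ih =>
    rw [Function.iterate_succ_apply']
    have := h (g^[k] N) (by omega)
    omega

theorem descents_le {g : ℕ → ℕ} {N : ℕ} (h : ∀ j ≤ N, g j ≤ j - 1) :
    descents g N ≤ N - 1 := by
  refine Nat.sInf_le ?_
  have := iterate_add_le h (N - 1 + 1)
  simp only [Set.mem_ofPred_eq]
  omega

theorem descents_succ {g : ℕ → ℕ} {N : ℕ} (h : ∀ j ≤ N, g j ≤ j - 1)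
    (hN : g N ≠ 0) : descents g N = descents g (g N) + 1 := by
  have hne : {k | g^[k + 1] N = 0}.Nonempty := by
    refine ⟨N - 1, ?_⟩
    have := iterate_add_le h (N - 1 + 1)
    simp only [Set.mem_ofPred_eq]
    omega
  have h1 : 1 ≤ sInf {k | g^[k + 1] N = 0} := by
    refine le_csInf hne fun k hk => ?_
    rcases Nat.eq_zero_or_pos k with rfl | hk'
    · exact absurd hk hN
    · exact hk'
  rw [descents, descents, ← Nat.sInf_add h1]
  rfl

theorem iterate_eq_iterate {g g' : ℕ → ℕ} {m : ℕ} (h : ∀ j ≤ m, g j = g' j)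
    (hle : ∀ j ≤ m, g j ≤ j - 1) (k : ℕ) : g^[k] m = g'^[k] m := by
  induction k with
  | zero => rfl
  | succ k ih =>
    rw [Function.iterate_succ_apply', Function.iterate_succ_apply', ← ih]
    have := iterate_add_le hle k
    exact h _ (by omega)

theorem descents_congr {g g' : ℕ → ℕ} {m : ℕ} (h : ∀ j ≤ m, g j = g' j)
    (hle : ∀ j ≤ m, g j ≤ j - 1) : descents g m = descents g' m := by
  unfold descents
  simp only [iterate_eq_iterate h hle]

/-- The generating function of the sequences with `g(N) = m` and `k` descents, with respect to the
sum of the terms. -/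
noncomputable def seqGF (k N m : ℕ) : ℤ[X] :=
  ∑ g ∈ boundedSeqs N N, if g N = m ∧ descents g N = k then X ^ total N g else 0

theorem seqGF_eq (k M m : ℕ) (hm : m ≤ M) :
    seqGF k (M + 1) m = ∑ g ∈ boundedSeqs M m,
      if descents (Function.update g (M + 1) m) (M + 1) = k then X ^ (total M g + m) else 0 := by
  rw [seqGF, sum_boundedSeqs_succ, min_eq_right (by omega),
    Finset.sum_eq_single_of_mem m (by simp; omega)]
  · simp [total_update]
  · intro e _ he
    simp [he]

theorem boundedSeqs_zero_right (u : ℕ) : boundedSeqs u 0 = {0} := by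
  ext g
  simp only [mem_boundedSeqs, Finset.mem_singleton]
  constructor
  · rintro ⟨h1, -, h2, h3⟩
    funext j
    rcases Nat.lt_or_ge u j with h | h
    · exact h1 j h
    · have := h2 j u h le_rfl
      simp only [Pi.zero_apply]
      omega
  · rintro rfl; simp

theorem seqGF_zero_right (k M : ℕ) : seqGF k (M + 1) 0 = if k = 0 then 1 else 0 := by
  rw [seqGF_eq _ _ _ (Nat.zero_le _), boundedSeqs_zero_right, Finset.sum_singleton,
    descents_eq_zero (by simp)]
  simp [total, eq_comm]

theorem descents_update {M m : ℕ} {g : ℕ → ℕ} (hg : g ∈ boundedSeqs M m) (h0 : 0 < m)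
    (hm : m ≤ M) :
    descents (Function.update g (M + 1) m) (M + 1) = descents (trunc m g) m + 1 := by
  obtain ⟨-, h2, -, -⟩ := mem_boundedSeqs.1 hg
  have hle : ∀ j ≤ M + 1, Function.update g (M + 1) m j ≤ j - 1 := by
    intro j hj
    by_cases h : j = M + 1
    · rw [h, Function.update_self]; omega
    · rw [Function.update_of_ne h]; exact h2 j (by omega)
  rw [descents_succ hle (by simp; omega),
    Function.update_self]
  congr 1
  refine descents_congr (fun j hj => ?_) fun j hj => hle j (by omega)
  rw [Function.update_of_ne (by omega), trunc, if_pos hj]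

theorem seqGF_zero_left (M m : ℕ) (h0 : 0 < m) (hm : m ≤ M) : seqGF 0 (M + 1) m = 0 := by
  rw [seqGF_eq _ _ _ hm]
  refine Finset.sum_eq_zero fun g hg => ?_
  rw [descents_update hg h0 hm, if_neg (by omega)]

/-- Here `l = g m` is the second value of the orbit of `M + 1`. The terms up to `g m` contribute
`seqGF k m l`; the `M - m` terms between `m` and `M + 1` form any monotone sequence in `[l, m]`,
which gives `X ^ (l * (M - m))` and the `t`-binomial; the last term `m` gives `X ^ m`. -/
theorem seqGF_succ (k M m : ℕ) (h0 : 0 < m) (hm : m ≤ M) :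
    seqGF (k + 1) (M + 1) m = ∑ l ∈ Finset.range m,
      seqGF k m l * (X ^ (l * (M - m) + m) * tBinom (M - l) (m - l)) := by
  obtain ⟨p, rfl⟩ := Nat.exists_eq_add_of_le hm
  have h1 := sum_boundedSeqs_add m p m le_rfl fun g => if descents g m = k then 1 else 0
  have h2 : seqGF (k + 1) (m + p + 1) m = X ^ m * ∑ g ∈ boundedSeqs (m + p) m,
      (if descents (trunc m g) m = k then 1 else 0) * X ^ total (m + p) g := by
    rw [seqGF_eq _ _ _ hm, Finset.mul_sum]
    refine Finset.sum_congr rfl fun g hg => ?_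
    rw [descents_update hg h0 hm]
    simp only [add_left_inj]
    split_ifs
    · ring
    · ring
  rw [h2, h1, Finset.mul_sum]
  simp only [seqGF, Finset.sum_mul]
  rw [Finset.sum_comm]
  refine Finset.sum_congr rfl fun g hg => ?_
  have hgm : g m < m := by
    have := (mem_boundedSeqs.1 hg).2.1 m le_rfl
    omega
  rw [Finset.sum_eq_single_of_mem (g m) (by simpa using hgm)]
  · have e1 : m + p - m = p := by omega
    rw [e1, add_comm p m]
    simp only [true_and]
    split_ifs
    · ring
    · ring
  · intro l _ hl
    rw [if_neg (by tauto), zero_mul]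

theorem sum_boundedSeqs_eq (n : ℕ) :
    ∑ g ∈ boundedSeqs (n + 1) (n + 1),
      (C (X ^ total (n + 1) g) * X ^ descents g (n + 1) : ℤ[X][X]) =
    ∑ k ∈ Finset.range (n + 1), C (∑ m ∈ Finset.range (n + 1), seqGF k (n + 1) m) * X ^ k := by
  simp only [seqGF, map_sum, Finset.sum_mul]
  have : ∀ k ∈ Finset.range (n + 1), ∀ f : ℕ → (ℕ → ℕ) → ℤ[X][X],
    ∑ m ∈ Finset.range (n + 1), ∑ g ∈ boundedSeqs (n + 1) (n + 1), f m g =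
    ∑ g ∈ boundedSeqs (n + 1) (n + 1), ∑ m ∈ Finset.range (n + 1), f m g :=
    fun k _ f => Finset.sum_comm
  rw [Finset.sum_congr rfl fun k hk => this k hk _, Finset.sum_comm]
  refine Finset.sum_congr rfl fun g hg => ?_
  have h1 := (mem_boundedSeqs.1 hg).2.1
  have h2 := h1 (n + 1) le_rfl
  have h3 := descents_le h1
  rw [Finset.sum_eq_single_of_mem (descents g (n + 1)) (by simp; omega),
    Finset.sum_eq_single_of_mem (g (n + 1)) (by simp; omega)]
  · simp
  · intro m _ hm
    rw [if_neg (by tauto), map_zero, zero_mul]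
  · intro k _ hk
    refine Finset.sum_eq_zero fun m _ => ?_
    rw [if_neg (by tauto), map_zero, zero_mul]

/-! ### Strictly increasing sequences -/

open Classical in
/-- The sequences `0 = s(0) < s(1) < ⋯ < s(k + 1) = N`, extended by `0`. -/
noncomputable def chains : ℕ → ℕ → Finset (ℕ → ℕ)
  | 0, N => if 0 < N then {Function.update (0 : ℕ → ℕ) 1 N} else ∅
  | k + 1, N => (Finset.range N).biUnion fun m =>
      (chains k m).image fun s => Function.update s (k + 2) N

theorem mem_chains {k N : ℕ} {s : ℕ → ℕ} :
    s ∈ chains k N ↔ s 0 = 0 ∧ s (k + 1) = N ∧ (∀ j ≤ k, s j < s (j + 1)) ∧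
      ∀ j, k + 1 < j → s j = 0 := by
  induction k generalizing N s with
  | zero =>
    rw [chains]
    constructor
    · intro h
      split_ifs at h with hN
      · rw [Finset.mem_singleton] at h
        subst h
        refine ⟨by simp, by simp, fun j hj => ?_, fun j hj => ?_⟩
        · obtain rfl : j = 0 := by omega
          simpa using hN
        · rw [Function.update_of_ne (by omega)]; rfl
      · simp at h
    · rintro ⟨h1, rfl, h3, h4⟩
      have := h3 0 le_rfl
      rw [if_pos (by omega), Finset.mem_singleton]
      funext j
      rcases j with - | - | j
      · simpa using h1
      · simp
      · rw [Function.update_of_ne (by omega), h4 _ (by omega)]; rfl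
  | succ k ih =>
    simp only [chains, Finset.mem_biUnion, Finset.mem_image, Finset.mem_range, ih]
    constructor
    · rintro ⟨m, hm, s, ⟨h1, h2, h3, h4⟩, rfl⟩
      refine ⟨by rwa [Function.update_of_ne (by omega)], by simp, fun j hj => ?_, fun j hj => ?_⟩
      · rcases Nat.lt_or_ge k j with h | h
        · obtain rfl : j = k + 1 := by omega
          rw [Function.update_self, Function.update_of_ne (by omega)]
          omega
        · rw [Function.update_of_ne (by omega), Function.update_of_ne (by omega)]
          exact h3 j h
      · rw [Function.update_of_ne (by omega)]
        exact h4 j (by omega)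
    · rintro ⟨h1, h2, h3, h4⟩
      have := h3 (k + 1) le_rfl
      refine ⟨s (k + 1), by omega, Function.update s (k + 2) 0,
        ⟨by rwa [Function.update_of_ne (by omega)], by rw [Function.update_of_ne (by omega)],
        fun j hj => ?_, fun j hj => ?_⟩, ?_⟩
      · rw [Function.update_of_ne (by omega), Function.update_of_ne (by omega)]
        exact h3 j (by omega)
      · by_cases h : j = k + 2
        · subst h; simp
        · rw [Function.update_of_ne h]; exact h4 j (by omega)
      · rw [Function.update_idem, ← h2, Function.update_eq_self]

theorem sum_chains_succ {M : Type*} [AddCommMonoid M] (k N : ℕ) (w : (ℕ → ℕ) → M) :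
    ∑ s ∈ chains (k + 1) N, w s =
      ∑ m ∈ Finset.range N, ∑ s ∈ chains k m, w (Function.update s (k + 2) N) := by
  classical
  rw [chains, Finset.sum_biUnion]
  · refine Finset.sum_congr rfl fun m _ => ?_
    rw [Finset.sum_image]
    intro s hs s' hs' h
    have h1 := (mem_chains.1 hs).2.2.2 (k + 2) (by omega)
    have h2 := (mem_chains.1 hs').2.2.2 (k + 2) (by omega)
    funext j
    by_cases hj : j = k + 2
    · rw [hj, h1, h2]
    · have := congrFun h j
      simpa [Function.update_of_ne hj] using this
  · intro m _ m' _ hne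
    rw [Function.onFun, Finset.disjoint_left]
    intro s hs hs'
    obtain ⟨a, ha, rfl⟩ := Finset.mem_image.1 hs
    obtain ⟨a', ha', h⟩ := Finset.mem_image.1 hs'
    have := congrFun h (k + 1)
    rw [Function.update_of_ne (by omega), Function.update_of_ne (by omega),
      (mem_chains.1 ha).2.1, (mem_chains.1 ha').2.1] at this
    exact hne this.symm

theorem chains_zero_right (k : ℕ) : chains k 0 = ∅ := by
  cases k <;> simp [chains]

/-- The generating function of the sequences `g` whose iterates pass through the sequence `s`. -/
noncomputable def chainWeight (k : ℕ) (s : ℕ → ℕ) : ℤ[X] :=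
  ∏ j ∈ Finset.range k, (X ^ (s j * (s (j + 2) - 1 - s (j + 1)) + s (j + 1)) *
    tBinom (s (j + 2) - 1 - s j) (s (j + 1) - s j))

theorem chainWeight_congr {k : ℕ} {s s' : ℕ → ℕ} (h : ∀ j ≤ k + 1, s j = s' j) :
    chainWeight k s = chainWeight k s' := by
  refine Finset.prod_congr rfl fun j hj => ?_
  have hj' : j < k := by simpa using hj
  rw [h j (by omega), h (j + 1) (by omega), h (j + 2) (by omega)]

/-- Unrolling `seqGF_succ`: the successive values of `l` are the members of the chain, read from the
top, and each step contributes one factor of `chainWeight`. -/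
theorem sum_chains_eq_seqGF (k M m : ℕ) (hm : m ≤ M) :
    ∑ s ∈ chains k (M + 1), (if s k = m then chainWeight k s else 0) = seqGF k (M + 1) m := by
  induction k generalizing M m with
  | zero =>
    rw [chains, if_pos (by omega), Finset.sum_singleton]
    rcases Nat.eq_zero_or_pos m with rfl | h
    · simp [seqGF_zero_right, chainWeight]
    · rw [seqGF_zero_left _ _ h hm, if_neg]
      simp; omega
  | succ k ih =>
    rw [sum_chains_succ, Finset.sum_eq_single_of_mem m (by simp; omega)]
    · rcases m with - | m
      · simp [chains_zero_right, seqGF_zero_right]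
      · rw [seqGF_succ _ _ _ (by omega) hm]
        have h1 : ∀ l ∈ Finset.range (m + 1), seqGF k (m + 1) l *
            (X ^ (l * (M - (m + 1)) + (m + 1)) * tBinom (M - l) (m + 1 - l)) =
            ∑ s ∈ chains k (m + 1), if s k = l then chainWeight k s *
              (X ^ (l * (M - (m + 1)) + (m + 1)) * tBinom (M - l) (m + 1 - l)) else 0 := by
          intro l hl
          rw [← ih m l (by simp at hl; omega), Finset.sum_mul]
          simp only [ite_mul, zero_mul]
        rw [Finset.sum_congr rfl h1, Finset.sum_comm]
        refine Finset.sum_congr rfl fun s hs => ?_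
        obtain ⟨-, h2, h3, -⟩ := mem_chains.1 hs
        have := h3 k le_rfl
        rw [if_pos (by rw [Function.update_of_ne (by omega), h2]), Finset.sum_ite_eq,
          if_pos (by simp; omega), chainWeight,
          Finset.prod_range_succ, ← chainWeight,
          chainWeight_congr fun j hj => Function.update_of_ne (by omega) _ _,
          Function.update_self, Function.update_of_ne (by omega),
          Function.update_of_ne (by omega), h2, Nat.add_sub_cancel]
    · intro l _ hl
      refine Finset.sum_eq_zero fun s hs => ?_
      rw [if_neg]
      rw [Function.update_of_ne (by omega), (mem_chains.1 hs).2.1]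
      exact hl

theorem sum_seqGF (k n : ℕ) :
    ∑ m ∈ Finset.range (n + 1), seqGF k (n + 1) m =
      ∑ s ∈ chains k (n + 1), chainWeight k s := by
  rw [Finset.sum_congr rfl fun m hm =>
    (sum_chains_eq_seqGF k n m (by simp at hm; omega)).symm, Finset.sum_comm]
  refine Finset.sum_congr rfl fun s hs => ?_
  obtain ⟨-, h2, h3, -⟩ := mem_chains.1 hs
  have := h3 k le_rfl
  rw [Finset.sum_ite_eq, if_pos (by simp; omega)]

/-- The terms `a (j + 1) - a j` telescope to `a k`, and the remaining products `a j * (a (j + 2) - a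
(j + 1))` are those on the right with the index shifted by one; `a 0 = 0` removes the lower boundary
term. -/
theorem sum_exponents (k : ℕ) (a : ℕ → ℕ) (h0 : a 0 = 0) (h : ∀ j ≤ k + 1, a j < a (j + 1)) :
    ∑ j ∈ Finset.range k, (a j * (a (j + 2) - 1 - a (j + 1)) + a (j + 1)) +
      a k * (a (k + 2) - a (k + 1)) =
    ∑ j ∈ Finset.range k, a (j + 1) * (a (j + 3) - a (j + 2)) + a k := by
  induction k with
  | zero => simp [h0]
  | succ k ih =>
    have ih := ih fun j hj => h j (by omega)
    obtain ⟨x, hx⟩ := Nat.exists_eq_add_of_lt (h (k + 1) (by omega))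
    change a (k + 2) = _ at hx
    rw [Finset.sum_range_succ, Finset.sum_range_succ]
    have e1 : a (k + 2) - 1 - a (k + 1) = x := by omega
    have e2 : a (k + 2) - a (k + 1) = x + 1 := by omega
    rw [e1]
    rw [e2] at ih
    change _ + a (k + 1) * (a (k + 3) - a (k + 2)) =
      _ + a (k + 1) * (a (k + 3) - a (k + 2)) + a (k + 1)
    linarith

theorem sum_indexSeqs (n k : ℕ) :
    ∑ i ∈ indexSeqs n k, seqWeight i = ∑ s ∈ chains k (n + 1), chainWeight k s := by
  refine Finset.sum_bij
    (fun i _ j => if h : j ≤ k + 1 then (i ⟨j, by omega⟩ : ℕ) else 0) ?_ ?_ ?_ ?_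
  · intro i hi
    obtain ⟨hmono, h0, h1, -⟩ := (Finset.mem_filter.1 hi).2
    refine mem_chains.2 ⟨by simpa using h0, by simpa using h1, fun j hj => ?_, fun j hj => ?_⟩
    · rw [dif_pos (by omega), dif_pos (by omega)]
      exact hmono (Fin.mk_lt_mk.2 (Nat.lt_succ_self j))
    · rw [dif_neg (by omega)]
  · intro i hi i' hi' h
    obtain ⟨-, -, -, h2⟩ := (Finset.mem_filter.1 hi).2
    obtain ⟨-, -, -, h2'⟩ := (Finset.mem_filter.1 hi').2
    funext ⟨j, hj⟩
    ext
    rcases Nat.lt_or_ge (k + 1) j with hk | hk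
    · obtain rfl : j = k + 2 := by omega
      rw [h2, h2']
    · have := congrFun h j
      simpa only [dif_pos hk] using this
  · intro s hs
    obtain ⟨h1, h2, h3, h4⟩ := mem_chains.1 hs
    have hmono : ∀ i j, i < j → j ≤ k + 1 → s i < s j := by
      intro i j hij
      induction j, hij using Nat.le_induction with
      | base => exact fun hj => h3 i (by omega)
      | succ j hj ih => exact fun hj' => (ih (by omega)).trans (h3 j (by omega))
    have hle : ∀ j ≤ k + 1, s j ≤ n + 1 := by
      intro j hj
      rcases hj.lt_or_eq with h | rfl
      · exact h2 ▸ (hmono j (k + 1) h le_rfl).le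
      · exact h2.le
    refine ⟨fun j => if h : (j : ℕ) ≤ k + 1 then ⟨s j, by have := hle j h; omega⟩
      else ⟨n + 2, by omega⟩, ?_, ?_⟩
    · refine Finset.mem_filter.2 ⟨Finset.mem_univ _, ?_, by simpa using h1, by simpa using h2,
        by simp⟩
      intro i j hij
      have hij' : (i : ℕ) < j := hij
      by_cases hj : (j : ℕ) ≤ k + 1
      · simp only [dif_pos hj, dif_pos (hij'.le.trans hj)]
        exact Fin.mk_lt_mk.2 (hmono i j hij' hj)
      · have hi : (i : ℕ) ≤ k + 1 := by omega
        simp only [dif_neg hj, dif_pos hi]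
        exact Fin.mk_lt_mk.2 (by have := hle i hi; omega)
    · funext j
      split_ifs with h
      · simp [h]
      · exact (h4 j (by omega)).symm
  · intro i hi
    obtain ⟨hmono, h0, h1, h2⟩ := (Finset.mem_filter.1 hi).2
    let a : ℕ → ℕ := fun j => if h : j < k + 3 then (i ⟨j, h⟩ : ℕ) else 0
    have ha : ∀ j (h : j < k + 3), (i ⟨j, h⟩ : ℕ) = a j := fun j h => by simp [a, h]
    have h1' : a (k + 1) = n + 1 := by rw [← ha _ (by omega), h1]
    have h2' : a (k + 2) = n + 2 := by rw [← ha _ (by omega), h2]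
    have key := sum_exponents k a (by rw [← ha _ (by omega), h0]) fun j hj => by
      rw [← ha _ (by omega), ← ha _ (by omega)]
      exact hmono (Fin.mk_lt_mk.2 (Nat.lt_succ_self j))
    -- The convention `i_{k+2} = n + 2` makes the last gap equal to 1, so that the boundary terms of
    -- `sum_exponents` are both `a k` and cancel.
    rw [h1', h2', show n + 2 - (n + 1) = 1 by omega, mul_one, add_left_inj] at key
    rw [seqWeight, chainWeight_congr (s' := a) fun j hj => by
      rw [dif_pos hj, ha]]
    simp only [ha]
    rw [Fin.prod_univ_eq_prod_range (fun j => X ^ (a (j + 1) * (a (j + 3) - a (j + 2))) *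
      tBinom (a (j + 2) - a j - 1) (a (j + 1) - a j)) k, chainWeight, Finset.prod_mul_distrib,
      Finset.prod_mul_distrib, Finset.prod_pow_eq_pow_sum, Finset.prod_pow_eq_pow_sum, key]
    simp only [Nat.sub_right_comm]

theorem sum_boundedSeqs_eq_sum_indexSeqs (n : ℕ) :
    ∑ g ∈ boundedSeqs (n + 1) (n + 1),
      (C (X ^ total (n + 1) g) * X ^ descents g (n + 1) : ℤ[X][X]) =
    ∑ k ∈ Finset.range (n + 1), C (∑ i ∈ indexSeqs n k, seqWeight i) * X ^ k := by
  simp only [sum_boundedSeqs_eq, sum_seqGF, sum_indexSeqs]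

/-! ### Dyck paths and area -/

/-- The number of pairs of a down-step and a later up-step. -/
def coarea (l : List DyckStep) : ℕ :=
  ∑ j ∈ Finset.range l.length,
    if l[j]? = some DyckStep.U then (l.take j).count DyckStep.D else 0

theorem coarea_concat (l : List DyckStep) (s : DyckStep) :
    coarea (l ++ [s]) = coarea l + if s = DyckStep.U then l.count DyckStep.D else 0 := by
  rw [coarea, List.length_append, List.length_singleton, Finset.sum_range_succ]
  congr 1
  · refine Finset.sum_congr rfl fun j hj => ?_
    have hj : j < l.length := by simpa using hj
    rw [List.getElem?_append_left hj, List.take_append_of_le_length hj.le]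
  · simp

/-- Stated for arbitrary words with signed ordinates so that induction on the last step applies. For
`m` steps of each kind the right side is `m ^ 2 - 2 * coarea l`. -/
theorem sum_heights_eq (l : List DyckStep) :
    ∑ j ∈ Finset.range l.length,
      ((((l.take j).count DyckStep.U : ℚ) - (l.take j).count DyckStep.D) +
        (((l.take (j + 1)).count DyckStep.U : ℚ) - (l.take (j + 1)).count DyckStep.D)) / 2 =
    (l.count DyckStep.U : ℚ) ^ 2 / 2 + l.count DyckStep.U * l.count DyckStep.D -
      (l.count DyckStep.D : ℚ) ^ 2 / 2 - 2 * coarea l := by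
  induction l using List.reverseRecOn with
  | nil => simp [coarea]
  | append_singleton l s ih =>
    rw [List.length_append, List.length_singleton, Finset.sum_range_succ, coarea_concat]
    have : ∀ j ∈ Finset.range l.length,
        (l ++ [s]).take j = l.take j ∧ (l ++ [s]).take (j + 1) = l.take (j + 1) := by
      intro j hj
      have hj : j < l.length := by simpa using hj
      exact ⟨List.take_append_of_le_length hj.le, List.take_append_of_le_length hj⟩
    rw [Finset.sum_congr rfl fun j hj => by rw [(this j hj).1, (this j hj).2], ih]
    rw [List.take_append_of_le_length le_rfl, List.take_of_length_le (by simp : _ ≤ l.length + 1),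
      List.take_length]
    cases s
    · simp
      ring
    · simp
      ring

theorem area_eq (p : DyckWord) : area p = (p.semilength : ℚ) ^ 2 - 2 * coarea p.toList := by
  have h1 : ∀ j, (ordinate p j : ℚ) =
      ((p.toList.take j).count DyckStep.U : ℚ) - (p.toList.take j).count DyckStep.D :=
    fun j => Nat.cast_sub (p.count_D_le_count_U j)
  simp only [area, h1]
  rw [sum_heights_eq, ← p.count_U_eq_count_D, DyckWord.semilength]
  ring

/-! ### Prefixes of Dyck paths and the coarea -/

open Classical in
/-- The initial segments of Dyck paths with `u` up-steps and `d` down-steps. -/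
noncomputable def dyckPrefixes : ℕ → ℕ → Finset (List DyckStep)
  | 0, 0 => {[]}
  | 0, _ + 1 => ∅
  | u + 1, 0 => (dyckPrefixes u 0).image (· ++ [DyckStep.U])
  | u + 1, d + 1 => (dyckPrefixes u (d + 1)).image (· ++ [DyckStep.U]) ∪
      if d ≤ u then (dyckPrefixes (u + 1) d).image (· ++ [DyckStep.D]) else ∅

/-- Every initial segment has at least as many up-steps as down-steps. -/
def StaysNonneg (l : List DyckStep) : Prop :=
  ∀ i, (l.take i).count DyckStep.D ≤ (l.take i).count DyckStep.U

theorem staysNonneg_concat {l : List DyckStep} {s : DyckStep} :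
    StaysNonneg (l ++ [s]) ↔ StaysNonneg l ∧
      (l ++ [s]).count DyckStep.D ≤ (l ++ [s]).count DyckStep.U := by
  constructor
  · intro h
    refine ⟨fun i => ?_, by simpa [List.take_of_length_le] using h (l.length + 1)⟩
    rcases le_total i l.length with hi | hi
    · have := h i
      rwa [List.take_append_of_le_length hi] at this
    · have := h l.length
      rwa [List.take_append_of_le_length le_rfl, List.take_length,
        ← List.take_of_length_le hi] at this
  · rintro ⟨h1, h2⟩ i
    rcases Nat.lt_or_ge l.length i with hi | hi
    · rwa [List.take_of_length_le (by simpa using hi)]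
    · rw [List.take_append_of_le_length hi]
      exact h1 i

theorem mem_dyckPrefixes {u d : ℕ} {l : List DyckStep} :
    l ∈ dyckPrefixes u d ↔
      l.count DyckStep.U = u ∧ l.count DyckStep.D = d ∧ StaysNonneg l := by
  induction l using List.reverseRecOn generalizing u d with
  | nil =>
    rcases u with - | u <;> rcases d with - | d
    · simp [dyckPrefixes, StaysNonneg]
    · simp [dyckPrefixes]
    · simp [dyckPrefixes]
    · simp only [dyckPrefixes]
      split_ifs <;> simp
  | append_singleton l s ih =>
    have hU : ∀ u d, l ++ [s] ∈ (dyckPrefixes u d).image (· ++ [DyckStep.U]) ↔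
        l ∈ dyckPrefixes u d ∧ s = DyckStep.U := by
      intro u d
      simp only [Finset.mem_image, List.append_singleton_inj]
      grind
    have hD : ∀ u d, l ++ [s] ∈ (dyckPrefixes u d).image (· ++ [DyckStep.D]) ↔
        l ∈ dyckPrefixes u d ∧ s = DyckStep.D := by
      intro u d
      simp only [Finset.mem_image, List.append_singleton_inj]
      grind
    have hl : StaysNonneg l → l.count DyckStep.D ≤ l.count DyckStep.U := fun h => by
      simpa using h l.length
    rw [staysNonneg_concat]
    rcases u with - | u <;> rcases d with - | d
    · cases s <;> simp [dyckPrefixes]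
    · cases s <;> simp [dyckPrefixes]
      grind
    · cases s <;> simp [dyckPrefixes, hU, ih]
      grind
    · rw [dyckPrefixes, Finset.mem_union, hU]
      split_ifs with h
      · rw [hD, ih, ih]
        cases s <;> simp <;> grind
      · rw [ih]
        cases s <;> simp
        · grind
        · grind

/-- A prefix corresponds to the sequence counting the down-steps before each up-step. Removing a
final down-step lowers the bound `d`; removing a final up-step deletes a last term equal to `d`.
Both sides satisfy this recursion. -/
theorem sum_dyckPrefixes (u d : ℕ) (h : d ≤ u) :
    ∑ l ∈ dyckPrefixes u d, (X : ℤ[X]) ^ coarea l =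
      ∑ g ∈ boundedSeqs u d, (X : ℤ[X]) ^ total u g := by
  classical
  have hU : ∀ u d, ∑ l ∈ (dyckPrefixes u d).image (· ++ [DyckStep.U]), (X : ℤ[X]) ^ coarea l =
      X ^ d * ∑ l ∈ dyckPrefixes u d, (X : ℤ[X]) ^ coarea l := by
    intro u d
    rw [Finset.sum_image fun a _ b _ h => by simpa using h, Finset.mul_sum]
    refine Finset.sum_congr rfl fun l hl => ?_
    rw [coarea_concat, if_pos rfl, (mem_dyckPrefixes.1 hl).2.1, pow_add, mul_comm]
  have hD : ∀ u d, ∑ l ∈ (dyckPrefixes u d).image (· ++ [DyckStep.D]), (X : ℤ[X]) ^ coarea l =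
      ∑ l ∈ dyckPrefixes u d, (X : ℤ[X]) ^ coarea l := by
    intro u d
    rw [Finset.sum_image fun a _ b _ h => by simpa using h]
    refine Finset.sum_congr rfl fun l hl => ?_
    rw [coarea_concat, if_neg (by decide), add_zero]
  have hG : ∀ u d, d ≤ u → ∑ g ∈ boundedSeqs (u + 1) d, (X : ℤ[X]) ^ total (u + 1) g =
      ∑ e ∈ Finset.range (d + 1), X ^ e * ∑ g ∈ boundedSeqs u e, (X : ℤ[X]) ^ total u g := by
    intro u d h
    rw [sum_boundedSeqs_succ, min_eq_left h]
    refine Finset.sum_congr rfl fun e _ => ?_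
    rw [Finset.mul_sum]
    exact Finset.sum_congr rfl fun g _ => by rw [total_update, pow_add, mul_comm]
  induction u generalizing d with
  | zero =>
    obtain rfl : d = 0 := by omega
    simp [dyckPrefixes, boundedSeqs, coarea, total]
  | succ u ihu =>
    induction d with
    | zero =>
      rw [dyckPrefixes, hU, hG _ _ (Nat.zero_le _), ihu _ (Nat.zero_le _)]
      simp
    | succ d ihd =>
      rw [dyckPrefixes, if_pos (by omega), Finset.sum_union, hU, hD, ihd (by omega)]
      · rcases (Nat.succ_le_succ_iff.1 h).lt_or_eq with h' | rfl
        · rw [hG _ _ (by omega), hG _ _ (by omega), Finset.sum_range_succ _ (d + 1), ihu _ h',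
            add_comm]
        -- On the diagonal a path cannot end in an up-step, and correspondingly the last term of `g`
        -- can never reach the bound.
        · have : dyckPrefixes d (d + 1) = ∅ := by
            refine Finset.eq_empty_of_forall_notMem fun l hl => ?_
            obtain ⟨h1, h2, h3⟩ := mem_dyckPrefixes.1 hl
            have := h3 l.length
            rw [List.take_length] at this
            omega
          rw [this, Finset.sum_empty, mul_zero, zero_add, sum_boundedSeqs_succ,
            sum_boundedSeqs_succ, min_self, min_eq_right (by omega)]
      · rw [Finset.disjoint_left]
        intro l hl hl'
        obtain ⟨a, -, rfl⟩ := Finset.mem_image.1 hl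
        obtain ⟨b, -, h⟩ := Finset.mem_image.1 hl'
        simp at h

theorem sum_dyckPath_coarea (m : ℕ) :
    ∑ p : DyckPath m, (X : ℤ[X]) ^ coarea p.1.toList =
      ∑ g ∈ boundedSeqs m m, (X : ℤ[X]) ^ total m g := by
  rw [← sum_dyckPrefixes m m le_rfl]
  refine Finset.sum_bij (fun p _ => p.1.toList) (fun p _ => ?_) (fun p _ q _ h => ?_)
    (fun l hl => ?_) fun p _ => rfl
  · exact mem_dyckPrefixes.2 ⟨p.2, p.1.semilength_eq_count_D.symm.trans p.2,
      p.1.count_D_le_count_U⟩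
  · exact Subtype.ext (DyckWord.ext h)
  · obtain ⟨h1, h2, h3⟩ := mem_dyckPrefixes.1 hl
    exact ⟨⟨⟨l, h1.trans h2.symm, h3⟩, h1⟩, Finset.mem_univ _, rfl⟩

theorem exists_area_weight (n : ℕ) :
    ∃ w : DyckPath (n + 1) → ℕ,
      (∀ p, (w p : ℚ) = ((n : ℚ) + 1) ^ 2 / 2 - area p.1 / 2) ∧
      ∑ g ∈ boundedSeqs (n + 1) (n + 1), (X : ℤ[X]) ^ total (n + 1) g =
        ∑ p, (X : ℤ[X]) ^ w p := by
  refine ⟨fun p => coarea p.1.toList, fun p => ?_, (sum_dyckPath_coarea (n + 1)).symm⟩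
  rw [area_eq, p.2]
  push_cast
  ring

/-! ### Dyck paths and height -/

/-- No initial segment has more than `h` up-steps in excess of its down-steps. -/
def StaysBelow (h : ℕ) (l : List DyckStep) : Prop :=
  ∀ i, (l.take i).count DyckStep.U ≤ (l.take i).count DyckStep.D + h

/-- After an up-step the path keeps climbing until its next down-step, and there it has a peak at
least as high. The induction is on a bound `k` for the number of remaining steps. -/
theorem ordinate_le_height_of_up (p : DyckWord) (k : ℕ) :
    ∀ j, p.toList.length ≤ j + 1 + k → p.toList[j]? = some DyckStep.U →
      ordinate p (j + 1) ≤ height p := by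
  induction k with
  | zero =>
    intro j hj _
    rw [ordinate, List.take_of_length_le (by omega), p.count_U_eq_count_D, Nat.sub_self]
    exact Nat.zero_le _
  | succ k ih =>
    intro j hj hU
    rcases h : p.toList[j + 1]? with - | s
    · rw [List.getElem?_eq_none_iff] at h
      rw [ordinate, List.take_of_length_le (by omega), p.count_U_eq_count_D, Nat.sub_self]
      exact Nat.zero_le _
    · rcases s.dichotomy with rfl | rfl
      · refine le_trans ?_ (ih (j + 1) (by omega) h)
        have h1 : p.toList.take (j + 1 + 1) = p.toList.take (j + 1) ++ [DyckStep.U] := by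
          rw [List.take_add_one, h]; rfl
        rw [ordinate, ordinate, h1]
        simp
        omega
      · have hj' : j < p.toList.length := by
          by_contra hc
          rw [List.getElem?_eq_none_iff.2 (by omega)] at hU
          simp at hU
        exact Finset.le_sup (f := fun j => ordinate p (j + 1))
          (Finset.mem_filter.2 ⟨Finset.mem_range.2 hj', hU, h⟩)

theorem ordinate_le_height (p : DyckWord) (j : ℕ) : ordinate p j ≤ height p := by
  induction j with
  | zero => simp [ordinate]
  | succ j ih =>
    rcases h : p.toList[j]? with - | s
    · have : p.toList.take (j + 1) = p.toList.take j := by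
        rw [List.take_add_one, h]; simp
      rwa [ordinate, this]
    · rcases s.dichotomy with rfl | rfl
      · exact ordinate_le_height_of_up p p.toList.length j (by omega) h
      · refine le_trans ?_ ih
        have h1 : p.toList.take (j + 1) = p.toList.take j ++ [DyckStep.D] := by
          rw [List.take_add_one, h]; rfl
        rw [ordinate, ordinate, h1]
        simp
        omega

/-- Replaces the maximum over peaks by a bound on all prefixes, a condition that behaves well under
concatenation and nesting. -/
theorem height_le_iff (p : DyckWord) (h : ℕ) : height p ≤ h ↔ StaysBelow h p.toList := by
  constructor
  · intro hp i
    have := (ordinate_le_height p i).trans hp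
    rw [ordinate] at this
    omega
  · intro hp
    refine Finset.sup_le fun j _ => ?_
    have := hp (j + 1)
    rw [ordinate]
    omega

theorem staysBelow_append {h : ℕ} {l l' : List DyckStep}
    (hl : l.count DyckStep.U = l.count DyckStep.D) :
    StaysBelow h (l ++ l') ↔ StaysBelow h l ∧ StaysBelow h l' := by
  constructor
  · intro hb
    refine ⟨fun i => ?_, fun i => ?_⟩
    · rcases le_total i l.length with hi | hi
      · have := hb i
        rwa [List.take_append_of_le_length hi] at this
      · rw [List.take_of_length_le hi, hl]
        omega
    · have := hb (l.length + i)
      rw [List.take_length_add_append] at this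
      simp only [List.count_append] at this
      omega
  · rintro ⟨h1, h2⟩ i
    rw [List.take_append]
    rcases le_total i l.length with hi | hi
    · have := h1 i
      simpa [Nat.sub_eq_zero_of_le hi] using this
    · have := h2 (i - l.length)
      rw [List.take_of_length_le hi]
      simp only [List.count_append]
      omega

theorem staysBelow_nest (h : ℕ) (p : DyckWord) :
    StaysBelow (h + 1) p.nest.toList ↔ StaysBelow h p.toList := by
  have e : p.nest.toList = DyckStep.U :: (p.toList ++ [DyckStep.D]) := by
    simp [DyckWord.nest]
  rw [e]
  constructor
  · intro hb i
    rcases le_total i p.toList.length with hi | hi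
    · have := hb (i + 1)
      rw [List.take_succ_cons, List.take_append_of_le_length hi] at this
      simp at this
      omega
    · rw [List.take_of_length_le hi, p.count_U_eq_count_D]
      omega
  · intro hb i
    rcases i with - | i
    · simp
    · rw [List.take_succ_cons, List.take_append]
      have := hb i
      simp only [List.count_cons, List.count_append]
      rcases le_total i p.toList.length with hi | hi
      · simp [Nat.sub_eq_zero_of_le hi]
        omega
      · rcases hi.lt_or_eq with hi | rfl
        · rw [List.take_of_length_le (l := [DyckStep.D]) (by simp; omega)]
          simp
          omega
        · simp at this ⊢
          omega

theorem height_nest_add_le_iff (h : ℕ) (p q : DyckWord) :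
    height (p.nest + q) ≤ h + 1 ↔ height p ≤ h ∧ height q ≤ h + 1 := by
  rw [height_le_iff, height_le_iff, height_le_iff, ← staysBelow_nest h p]
  exact staysBelow_append p.nest.count_U_eq_count_D

theorem height_nest_add_pos (p q : DyckWord) : 0 < height (p.nest + q) := by
  by_contra hc
  have h0 : height (p.nest + q) ≤ 0 := by omega
  have := (height_le_iff _ _).1 h0 1
  have e : (p.nest + q).toList = DyckStep.U :: (p.toList ++ [DyckStep.D] ++ q.toList) := by
    change p.nest.toList ++ q.toList = _
    simp [DyckWord.nest]
  rw [e] at this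
  simp at this

theorem height_zero : height 0 = 0 := rfl

/-! ### First-return decomposition -/

open DyckWord in
theorem sum_dyckPath_eq_sum_trees {M : Type*} [AddCommMonoid M] (m : ℕ) (f : DyckWord → M) :
    ∑ p : DyckPath m, f p.1 = ∑ t ∈ BinaryTree.treesOfNumNodesEq m, f (ofTree t) := by
  refine Finset.sum_bij (fun p _ => p.1.toTree) (fun p _ => ?_) (fun p _ q _ h => ?_)
    (fun t ht => ?_) fun p _ => ?_
  · rw [BinaryTree.mem_treesOfNumNodesEq, numNodes_toTree, p.2]
  · exact Subtype.ext (equivTree.injective h)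
  · rw [BinaryTree.mem_treesOfNumNodesEq] at ht
    exact ⟨⟨ofTree t, by rw [← numNodes_toTree, toTree_ofTree, ht]⟩, Finset.mem_univ _,
      toTree_ofTree t⟩
  · rw [ofTree_toTree]

/-- The sum over Dyck paths from `(0,0)` to `(2m+2,0)` in terms of the first-return
decomposition. -/
theorem sum_dyckPath_succ {M : Type*} [AddCommMonoid M] (m : ℕ) (f : DyckWord → M) :
    ∑ p : DyckPath (m + 1), f p.1 =
      ∑ ij ∈ Finset.HasAntidiagonal.antidiagonal m, ∑ p : DyckPath ij.1, ∑ q : DyckPath ij.2,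
        f (p.1.nest + q.1) := by
  rw [sum_dyckPath_eq_sum_trees, BinaryTree.treesOfNumNodesEq_succ, Finset.sum_biUnion]
  · refine Finset.sum_congr rfl fun ij _ => ?_
    rw [sum_dyckPath_eq_sum_trees ij.1 fun p => ∑ q : DyckPath ij.2, f (p.nest + q.1)]
    simp only [fun p => sum_dyckPath_eq_sum_trees ij.2 fun q => f (DyckWord.nest p + q)]
    -- A node with subtrees `a` and `b` is sent by `ofTree` to the nested path of `a` followed by
    -- the path of `b`, definitionally.
    rw [BinaryTree.pairwiseNode, Finset.sum_map, Finset.sum_product]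
    rfl
  · intro ij _ ij' _ hne
    rw [Function.onFun, Finset.disjoint_left]
    intro t ht ht'
    simp only [BinaryTree.pairwiseNode, Finset.mem_map, Finset.mem_product,
      BinaryTree.mem_treesOfNumNodesEq] at ht ht'
    obtain ⟨⟨a, b⟩, ⟨h1, h2⟩, rfl⟩ := ht
    obtain ⟨⟨a', b'⟩, ⟨h1', h2'⟩, h⟩ := ht'
    have h : BinaryTree.node () a' b' = BinaryTree.node () a b := h
    rw [BinaryTree.node.injEq] at h
    obtain ⟨-, rfl, rfl⟩ := h
    exact hne (Prod.ext (h1.symm.trans h1') (h2.symm.trans h2'))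

/-- The number of Dyck paths from `(0,0)` to `(2m,0)` of height at most `k`. -/
noncomputable def boundedCount (k m : ℕ) : ℤ :=
  ∑ p : DyckPath m, if height p.1 ≤ k then 1 else 0

theorem boundedCount_zero_right (k : ℕ) : boundedCount k 0 = 1 := by
  rw [boundedCount, sum_dyckPath_eq_sum_trees 0 fun p => if height p ≤ k then (1 : ℤ) else 0,
    BinaryTree.treesOfNumNodesEq_zero, Finset.sum_singleton]
  change (if height 0 ≤ k then (1 : ℤ) else 0) = 1
  rw [height_zero, if_pos (Nat.zero_le _)]

theorem boundedCount_zero_succ (m : ℕ) : boundedCount 0 (m + 1) = 0 := by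
  rw [boundedCount, sum_dyckPath_succ m fun p => if height p ≤ 0 then (1 : ℤ) else 0]
  refine Finset.sum_eq_zero fun ij _ => Finset.sum_eq_zero fun p _ =>
    Finset.sum_eq_zero fun q _ => if_neg ?_
  have := height_nest_add_pos p.1 q.1
  omega

theorem boundedCount_succ_succ (k m : ℕ) :
    boundedCount (k + 1) (m + 1) =
      ∑ ij ∈ Finset.HasAntidiagonal.antidiagonal m, boundedCount k ij.1 * boundedCount (k + 1) ij.2 := by
  rw [boundedCount, sum_dyckPath_succ m fun p => if height p ≤ k + 1 then (1 : ℤ) else 0]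
  refine Finset.sum_congr rfl fun ij _ => ?_
  rw [boundedCount, boundedCount, Finset.sum_mul_sum]
  refine Finset.sum_congr rfl fun p _ => Finset.sum_congr rfl fun q _ => ?_
  simp only [height_nest_add_le_iff, ite_and, ite_mul, one_mul, zero_mul]

/-! ### Powers of the height generating functions -/

/-- The generating function of the Dyck paths of height at most `k` with respect to semilength. -/
noncomputable def heightGF (k : ℕ) : PowerSeries ℤ := PowerSeries.mk (boundedCount k)

theorem heightGF_zero : heightGF 0 = 1 := by
  ext m
  rw [heightGF, PowerSeries.coeff_mk, PowerSeries.coeff_one]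
  rcases m with - | m
  · rw [boundedCount_zero_right, if_pos rfl]
  · rw [boundedCount_zero_succ, if_neg (by omega)]

theorem heightGF_succ (k : ℕ) :
    heightGF (k + 1) = 1 + PowerSeries.X * heightGF k * heightGF (k + 1) := by
  ext m
  rw [map_add, PowerSeries.coeff_one, mul_assoc]
  rcases m with - | m
  · simp [heightGF, boundedCount_zero_right]
  · rw [PowerSeries.coeff_succ_X_mul, PowerSeries.coeff_mul, if_neg (by omega), zero_add]
    simp only [heightGF, PowerSeries.coeff_mk, boundedCount_succ_succ]

/-- The truncated series of `(1 - y)^{-(c+1)}`, multiplied by `1 - y`, is the truncated series of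
`(1 - y)^{-c}` up to one boundary term, by Pascal's rule. -/
theorem one_sub_mul_sum_choose {R : Type*} [CommRing R] (y : R) (c K : ℕ) :
    (1 - y) * ∑ e ∈ Finset.range (K + 1), ((c + e).choose e : R) * y ^ e =
      ∑ e ∈ Finset.range (K + 1), ((c + e - 1).choose e : R) * y ^ e -
        ((c + K).choose K : R) * y ^ (K + 1) := by
  induction K with
  | zero => simp
  | succ K ih =>
    rw [Finset.sum_range_succ, mul_add, ih, Finset.sum_range_succ _ (K + 1)]
    have : (c + (K + 1)).choose (K + 1) = (c + K).choose K + (c + K).choose (K + 1) :=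
      Nat.choose_succ_succ _ _
    rw [this, show c + (K + 1) - 1 = c + K by omega]
    push_cast
    ring

/-- The hypothesis says `D = 1 / (1 - X E)`, so this is the binomial series of `D ^ c` modulo `X ^
(K + 1)`. For `c = 0` the truncated `c + e - 1` still gives coefficient 1 at `e = 0` and 0 for `e >
0`. -/
theorem X_pow_dvd_pow_sub (D E : PowerSeries ℤ) (h : D = 1 + PowerSeries.X * E * D) (c K : ℕ) :
    (PowerSeries.X : PowerSeries ℤ) ^ (K + 1) ∣
      D ^ c - ∑ e ∈ Finset.range (K + 1),
        ((c + e - 1).choose e : PowerSeries ℤ) * (PowerSeries.X * E) ^ e := by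
  induction c with
  | zero =>
    rw [Finset.sum_range_succ', Finset.sum_eq_zero]
    · simp
    · intro e _
      rw [Nat.choose_eq_zero_of_lt (by omega)]
      simp
  | succ c ih =>
    obtain ⟨q, hq⟩ := ih
    have h1 := one_sub_mul_sum_choose (PowerSeries.X * E) c K
    have h2 : ∀ e, c + 1 + e - 1 = c + e := fun e => by omega
    simp only [h2]
    refine ⟨D * (q + ((c + K).choose K : PowerSeries ℤ) * E ^ (K + 1)), ?_⟩
    rw [mul_pow _ _ (K + 1)] at h1
    linear_combination (exp := 1) D * hq - D * h1 + (∑ e ∈ Finset.range (K + 1),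
      ((c + e).choose e : PowerSeries ℤ) * (PowerSeries.X * E) ^ e) * h

theorem coeff_heightGF_pow (k c M : ℕ) :
    PowerSeries.coeff M (heightGF (k + 1) ^ c) = ∑ l ∈ Finset.range (M + 1),
      ((c + (M - l) - 1).choose (M - l) : ℤ) * PowerSeries.coeff l (heightGF k ^ (M - l)) := by
  have h := PowerSeries.X_pow_dvd_iff.1
    (X_pow_dvd_pow_sub _ _ (heightGF_succ k) c M) M (Nat.lt_succ_self M)
  rw [map_sub, sub_eq_zero] at h
  rw [h, map_sum, ← Finset.sum_range_reflect]
  refine Finset.sum_congr rfl fun l hl => ?_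
  have hl : l ≤ M := by simpa [Nat.lt_succ_iff] using hl
  rw [show M + 1 - 1 - l = M - l by omega, mul_pow, ← Int.cast_natCast,
    ← map_intCast (PowerSeries.C (R := ℤ)), PowerSeries.coeff_C_mul]
  congr 1
  nth_rewrite 1 [show M = l + (M - l) by omega]
  rw [PowerSeries.coeff_X_pow_mul]

/-- At `t = 1` the recursion `seqGF_succ` has the coefficients `(M - l).choose (m - l)`, which are
exactly those in the expansion of `heightGF (k + 1) ^ (M + 1 - m)` in powers of `X * heightGF k`.
The exponent `M + 1 - m` is the one for which the two recursions coincide. -/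
theorem sum_eval_seqGF (k M m : ℕ) (hm : m ≤ M) :
    ∑ j ∈ Finset.range (k + 1), (seqGF j (M + 1) m).eval 1 =
      PowerSeries.coeff m (heightGF k ^ (M + 1 - m)) := by
  induction k generalizing M m with
  | zero =>
    rw [heightGF_zero, one_pow, PowerSeries.coeff_one]
    rcases m with - | m
    · simp [seqGF_zero_right]
    · simp [seqGF_zero_left _ _ (Nat.succ_pos m) hm]
  | succ k ih =>
    rw [Finset.sum_range_succ', coeff_heightGF_pow]
    rcases m with - | m
    · simp [seqGF_zero_right]
    · rw [seqGF_zero_left _ _ (Nat.succ_pos m) hm, eval_zero, add_zero,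
        Finset.sum_congr rfl fun j _ => by
          rw [seqGF_succ _ _ _ (Nat.succ_pos m) hm, eval_finsetSum], Finset.sum_comm,
        Finset.sum_range_succ _ (m + 1)]
      -- The term `l = m + 1` involves the zeroth power, whose coefficient in positive degree is 0;
      -- what is left has the summation range of `seqGF_succ`.
      have : PowerSeries.coeff (m + 1) (heightGF k ^ (m + 1 - (m + 1))) = 0 := by
        rw [Nat.sub_self, pow_zero, PowerSeries.coeff_one, if_neg (by omega)]
      rw [this, mul_zero, add_zero]
      refine Finset.sum_congr rfl fun l hl => ?_
      have hl : l ≤ m := by simpa [Nat.lt_succ_iff] using hl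
      rw [← ih m l hl, Finset.mul_sum]
      refine Finset.sum_congr rfl fun j _ => ?_
      rw [show M + 1 - (m + 1) + (m + 1 - l) - 1 = M - l by omega]
      simp [eval_one_tBinom, mul_comm]

/-- The expansion of the first power of `heightGF (k + 1)`: its binomial coefficients are all 1, so
the sum over the last value `m` is unweighted. -/
theorem sum_sum_eval_seqGF (k n : ℕ) :
    ∑ j ∈ Finset.range (k + 1), ∑ m ∈ Finset.range (n + 1), (seqGF j (n + 1) m).eval 1 =
      boundedCount (k + 1) (n + 1) := by
  have h := coeff_heightGF_pow k 1 (n + 1)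
  rw [pow_one, heightGF, PowerSeries.coeff_mk, Finset.sum_range_succ, Nat.sub_self, pow_zero,
    PowerSeries.coeff_one, if_neg (by omega), mul_zero, add_zero] at h
  rw [h, Finset.sum_comm]
  refine Finset.sum_congr rfl fun m hm => ?_
  rw [sum_eval_seqGF _ _ _ (by simp at hm; omega), Nat.add_sub_cancel_left, Nat.choose_self,
    Nat.cast_one, one_mul]

theorem sum_eval_seqGF_eq_card (k n : ℕ) :
    ∑ m ∈ Finset.range (n + 1), (seqGF k (n + 1) m).eval 1 =
      ∑ p : DyckPath (n + 1), if height p.1 = k + 1 then 1 else 0 := by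
  have h1 : ∑ p : DyckPath (n + 1), (if height p.1 = k + 1 then (1 : ℤ) else 0) =
      boundedCount (k + 1) (n + 1) - boundedCount k (n + 1) := by
    rw [boundedCount, boundedCount, ← Finset.sum_sub_distrib]
    refine Finset.sum_congr rfl fun p _ => ?_
    split_ifs <;> omega
  rw [h1, ← sum_sum_eval_seqGF, Finset.sum_range_succ _ k]
  rcases k with - | k
  · rw [boundedCount_zero_succ]; simp
  · rw [sum_sum_eval_seqGF]; ring

theorem seqGF_eq_zero {k n : ℕ} (h : n < k) (m : ℕ) : seqGF k (n + 1) m = 0 := by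
  refine Finset.sum_eq_zero fun g hg => if_neg ?_
  have := descents_le (mem_boundedSeqs.1 hg).2.1
  omega

theorem X_mul_sum_seqGF (n : ℕ) :
    X * (∑ k ∈ Finset.range (n + 1),
        C (∑ m ∈ Finset.range (n + 1), seqGF k (n + 1) m) * X ^ k : ℤ[X][X]).map
          (evalRingHom (1 : ℤ)) =
      ∑ p : DyckPath (n + 1), X ^ height p.1 := by
  ext j
  simp only [finsetSum_coeff, coeff_X_pow]
  rcases j with - | k
  · rw [coeff_X_mul_zero, eq_comm]
    -- The constant term vanishes because a path with at least one step has positive height.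
    have := boundedCount_zero_succ n
    rw [boundedCount] at this
    refine Eq.trans ?_ this
    exact Finset.sum_congr rfl fun p _ => by simp [eq_comm]
  · rw [coeff_X_mul, coeff_map, finsetSum_coeff]
    simp only [coeff_C_mul, coeff_X_pow, mul_ite, mul_one, mul_zero, Finset.sum_ite_eq]
    simp only [eq_comm (a := k + 1)]
    rw [← sum_eval_seqGF_eq_card]
    split_ifs with h
    · simp
    · have h' : n < k := by simpa using h
      simp [seqGF_eq_zero h']

/-! ### Ideals of a Lie algebra of triangular matrices -/

/-- The map `c` identifies `B` with the Lie algebra of traceless upper triangular matrices. -/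
structure IsTriangularModel {n : ℕ} {B : Type*} [LieRing B] [LieAlgebra ℂ B]
    (c : B →ₗ[ℂ] Matrix (Fin (n + 1)) (Fin (n + 1)) ℂ) : Prop where
  inj : Function.Injective c
  lie : ∀ x y, c ⁅x, y⁆ = c x * c y - c y * c x
  upper : ∀ x i j, j < i → c x i j = 0
  surj : ∀ A : Matrix (Fin (n + 1)) (Fin (n + 1)) ℂ, (∀ i j, j < i → A i j = 0) →
    A.trace = 0 → ∃ x, c x = A

section

variable {n : ℕ} {B : Type*} [LieRing B] [LieAlgebra ℂ B]
  {c : B →ₗ[ℂ] Matrix (Fin (n + 1)) (Fin (n + 1)) ℂ}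

theorem IsTriangularModel.exists_single (hc : IsTriangularModel c) {i j : Fin (n + 1)}
    (h : i < j) : ∃ x, c x = Matrix.single i j 1 := by
  refine hc.surj _ (fun k l hkl => ?_) (Matrix.trace_single_eq_of_ne i j 1 h.ne)
  rw [Matrix.single_apply, if_neg]
  rintro ⟨rfl, rfl⟩
  exact absurd h hkl.asymm

theorem single_mul_sub_apply (a : Fin (n + 1)) (M : Matrix (Fin (n + 1)) (Fin (n + 1)) ℂ)
    (k l : Fin (n + 1)) :
    (Matrix.single a a 1 * M - M * Matrix.single a a 1 : Matrix _ _ ℂ) k l =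
      ((if k = a then 1 else 0) - (if l = a then 1 else 0)) * M k l := by
  rw [Matrix.sub_apply, sub_mul]
  congr 1
  · by_cases h : k = a
    · subst h; simp
    · simp [h]
  · by_cases h : l = a
    · subst h; simp
    · simp [h]

theorem IsTriangularModel.exists_diagonal (hc : IsTriangularModel c) (a : Fin (n + 1)) :
    ∃ x : B, ∀ (y : B) (k l : Fin (n + 1)), c ⁅x, y⁆ k l =
      ((if k = a then 1 else 0) - (if l = a then 1 else 0)) * c y k l := by
  obtain ⟨x, hx⟩ := hc.surj
    -- Subtracting a scalar matrix makes the trace zero without changing any bracket.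
    (Matrix.single a a 1 - ((n : ℂ) + 1)⁻¹ • (1 : Matrix (Fin (n + 1)) (Fin (n + 1)) ℂ))
    (fun i j h => by
      rw [Matrix.sub_apply, Matrix.smul_apply, Matrix.one_apply_ne h.ne', Matrix.single_apply,
        if_neg (by rintro ⟨rfl, rfl⟩; exact h.false)]
      simp)
    (by
      rw [Matrix.trace_sub, Matrix.trace_smul, Matrix.trace_one, Matrix.trace_single_eq_same]
      have : (n : ℂ) + 1 ≠ 0 := by exact_mod_cast n.succ_ne_zero
      simp [this])
  refine ⟨x, fun y k l => ?_⟩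
  rw [hc.lie, hx, ← single_mul_sub_apply]
  rw [sub_mul, mul_sub, smul_mul_assoc, mul_smul_comm, one_mul, mul_one, sub_sub_sub_cancel_right]

/-- Bracketing with the diagonal elements for `j` and then `i` multiplies the entry `(k, l)` by
`(δ_ki - δ_li)(δ_kj - δ_lj)`. Above the diagonal this is nonzero only at `(i, j)`, where it equals
`-1`; hence the scalar `-(c x i j)⁻¹`. -/
theorem IsTriangularModel.mem_of_apply_ne_zero (hc : IsTriangularModel c) (I : LieIdeal ℂ B)
    {x z : B} (hx : x ∈ I) {i j : Fin (n + 1)} (hij : i < j) (h : c x i j ≠ 0)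
    (hz : c z = Matrix.single i j 1) (hdiag : ∀ k, c x k k = 0) : z ∈ I := by
  obtain ⟨u, hu⟩ := hc.exists_diagonal i
  obtain ⟨v, hv⟩ := hc.exists_diagonal j
  have key : z = (-(c x i j)⁻¹) • ⁅u, ⁅v, x⁆⁆ := by
    apply hc.inj
    ext k l
    rw [map_smul, Matrix.smul_apply, hu, hv, hz, Matrix.single_apply]
    rcases lt_trichotomy k l with hkl | rfl | hkl
    · by_cases h1 : i = k ∧ j = l
      · obtain ⟨rfl, rfl⟩ := h1
        simp [hij.ne, hij.ne', h]
      · rw [if_neg h1]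
        have : ((if k = i then (1 : ℂ) else 0) - if l = i then 1 else 0) *
            ((if k = j then (1 : ℂ) else 0) - if l = j then 1 else 0) = 0 := by
          by_cases h2 : k = i
          · subst h2
            rw [if_neg hij.ne, if_neg fun h3 : l = j => h1 ⟨rfl, h3.symm⟩, sub_zero, mul_zero]
          · by_cases h3 : l = i
            · subst h3
              rw [if_neg (hkl.trans hij).ne, if_neg hij.ne, sub_zero, mul_zero]
            · rw [if_neg h2, if_neg h3, sub_zero, zero_mul]
        rw [← mul_assoc, this]
        simp
    · rw [hdiag, if_neg (by rintro ⟨rfl, rfl⟩; exact hij.false)]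
      simp
    · rw [hc.upper x k l hkl, if_neg (by rintro ⟨rfl, rfl⟩; exact hij.asymm hkl)]
      simp
  rw [key]
  exact I.smul_mem _ (lie_mem_right ℂ B I _ _ (lie_mem_right ℂ B I _ _ hx))

theorem IsTriangularModel.lie_single (hc : IsTriangularModel c) {x y : B}
    {i j k : Fin (n + 1)} (hik : i ≠ k) (hx : c x = Matrix.single i j 1)
    (hy : c y = Matrix.single j k 1) : c ⁅x, y⁆ = Matrix.single i k 1 := by
  rw [hc.lie, hx, hy, Matrix.single_mul_single_same, one_mul,
    Matrix.single_mul_single_of_ne _ _ _ _ hik.symm, sub_zero]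

/-- The ideal of the matrices whose column `j` is supported in the first `g(j + 1)` rows. -/
def seqIdeal (hc : IsTriangularModel c) {g : ℕ → ℕ} (hg : g ∈ boundedSeqs (n + 1) (n + 1)) :
    LieIdeal ℂ B where
  carrier := {x | ∀ i j : Fin (n + 1), g (j + 1) ≤ i → c x i j = 0}
  zero_mem' := fun i j _ => by simp
  add_mem' := fun hx hy i j h => by simp [hx i j h, hy i j h]
  smul_mem' := fun a x hx i j h => by simp [hx i j h]
  lie_mem := fun {x y} hy i j h => by
    rw [hc.lie, Matrix.sub_apply, Matrix.mul_apply, Matrix.mul_apply, Finset.sum_eq_zero,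
      Finset.sum_eq_zero, sub_zero]
    · intro l _
      rcases lt_or_ge j l with hl | hl
      · rw [hc.upper x l j hl, mul_zero]
      · have := (mem_boundedSeqs.1 hg).2.2.1 (l + 1) (j + 1)
          (Nat.succ_le_succ hl) (by omega)
        rw [hy i l (this.trans h), zero_mul]
    · intro l _
      rcases lt_or_ge l i with hl | hl
      · rw [hc.upper x i l hl, zero_mul]
      · rw [hy l j (h.trans hl), mul_zero]

theorem mem_seqIdeal (hc : IsTriangularModel c) {g : ℕ → ℕ}
    (hg : g ∈ boundedSeqs (n + 1) (n + 1)) {x : B} :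
    x ∈ seqIdeal hc hg ↔ ∀ i j : Fin (n + 1), g (j + 1) ≤ i → c x i j = 0 := Iff.rfl

theorem single_mem_seqIdeal (hc : IsTriangularModel c) {g : ℕ → ℕ}
    (hg : g ∈ boundedSeqs (n + 1) (n + 1)) {x : B} {i j : Fin (n + 1)}
    (hx : c x = Matrix.single i j 1) : x ∈ seqIdeal hc hg ↔ (i : ℕ) < g (j + 1) := by
  rw [mem_seqIdeal]
  constructor
  · intro h
    by_contra hc'
    have := h i j (by omega)
    rw [hx, Matrix.single_apply_same] at this
    exact one_ne_zero this
  · intro h k l hkl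
    rw [hx, Matrix.single_apply, if_neg]
    rintro ⟨rfl, rfl⟩
    omega

theorem seq_apply_le {g : ℕ → ℕ} (hg : g ∈ boundedSeqs (n + 1) (n + 1)) (j : Fin (n + 1)) :
    g (j + 1) ≤ j := by
  have := (mem_boundedSeqs.1 hg).2.1 (j + 1) (by omega)
  simpa using this

theorem apply_diag_eq_zero (hc : IsTriangularModel c) {g : ℕ → ℕ}
    (hg : g ∈ boundedSeqs (n + 1) (n + 1)) {x : B} (hx : x ∈ seqIdeal hc hg)
    (i : Fin (n + 1)) : c x i i = 0 :=
  hx i i (seq_apply_le hg i)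

theorem seqIdeal_injective (hc : IsTriangularModel c) {g g' : ℕ → ℕ}
    (hg : g ∈ boundedSeqs (n + 1) (n + 1)) (hg' : g' ∈ boundedSeqs (n + 1) (n + 1))
    (h : seqIdeal hc hg = seqIdeal hc hg') : g = g' := by
  have key : ∀ {g g' : ℕ → ℕ} (hg : g ∈ boundedSeqs (n + 1) (n + 1))
      (hg' : g' ∈ boundedSeqs (n + 1) (n + 1)), seqIdeal hc hg = seqIdeal hc hg' →
      ∀ j : Fin (n + 1), g' (j + 1) ≤ g (j + 1) := by
    intro g g' hg hg' h j
    by_contra hlt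
    have h1 := seq_apply_le hg' j
    have hij : (⟨g (j + 1), by omega⟩ : Fin (n + 1)) < j := by
      rw [Fin.lt_def]; simp only; omega
    obtain ⟨x, hx⟩ := hc.exists_single hij
    have h2 := (single_mem_seqIdeal hc hg' hx).2 (by simp only; omega)
    rw [← h, single_mem_seqIdeal hc hg hx] at h2
    exact lt_irrefl _ h2
  funext j
  rcases j with - | j
  · rw [boundedSeqs_apply_zero hg, boundedSeqs_apply_zero hg']
  · by_cases hj : j < n + 1
    · exact le_antisymm (key hg' hg h.symm ⟨j, hj⟩) (key hg hg' h ⟨j, hj⟩)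
    · rw [(mem_boundedSeqs.1 hg).1 _ (by omega), (mem_boundedSeqs.1 hg').1 _ (by omega)]

/-- The set `R` of positions occurring in `I` consists of matrix units of `I`. It is closed upwards
and to the right because `[E_{i'i}, E_{ij}] = E_{i'j}` and `[E_{ij}, E_{jj'}] = E_{ij'}`. So each
column is filled from the top, to a depth that increases with the column. -/
theorem IsTriangularModel.exists_eq_seqIdeal (hc : IsTriangularModel c) (I : LieIdeal ℂ B)
    (hI : ∀ x ∈ I, ∀ i, c x i i = 0) :
    ∃ (g : ℕ → ℕ) (hg : g ∈ boundedSeqs (n + 1) (n + 1)), I = seqIdeal hc hg := by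
  classical
  let R : Fin (n + 1) → Fin (n + 1) → Prop := fun i j => ∃ x ∈ I, c x i j ≠ 0
  have hlt : ∀ {i j}, R i j → i < j := by
    rintro i j ⟨x, hx, h⟩
    rcases lt_trichotomy i j with h' | rfl | h'
    · exact h'
    · exact absurd (hI x hx i) h
    · exact absurd (hc.upper x i j h') h
  have hmem : ∀ {i j z}, R i j → c z = Matrix.single i j 1 → z ∈ I := by
    intro i j z hR hz
    obtain ⟨x, hx, h⟩ := id hR
    exact hc.mem_of_apply_ne_zero I hx (hlt hR) h hz (hI x hx)
  have hof : ∀ {i j z}, z ∈ I → c z = Matrix.single i j 1 → R i j := by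
    intro i j z hzI hz
    exact ⟨z, hzI, by rw [hz, Matrix.single_apply_same]; exact one_ne_zero⟩
  have hup : ∀ {i j i'}, R i j → i' ≤ i → R i' j := by
    intro i j i' hR hle
    rcases hle.lt_or_eq with h | rfl
    · obtain ⟨x, hx⟩ := hc.exists_single h
      obtain ⟨y, hy⟩ := hc.exists_single (hlt hR)
      exact hof (lie_mem_right ℂ B I x y (hmem hR hy))
        (hc.lie_single (h.trans (hlt hR)).ne hx hy)
    · exact hR
  have hright : ∀ {i j j'}, R i j → j ≤ j' → R i j' := by
    intro i j j' hR hle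
    rcases hle.lt_or_eq with h | rfl
    · obtain ⟨x, hx⟩ := hc.exists_single h
      obtain ⟨y, hy⟩ := hc.exists_single (hlt hR)
      exact hof (lie_mem_left ℂ B I y x (hmem hR hy))
        (hc.lie_single ((hlt hR).trans h).ne hy hx)
    · exact hR
  let g : ℕ → ℕ := fun m => Finset.univ.sup fun i : Fin (n + 1) =>
    if ∃ j : Fin (n + 1), (j : ℕ) + 1 = m ∧ R i j then (i : ℕ) + 1 else 0
  have hgR : ∀ i j : Fin (n + 1), (i : ℕ) < g (j + 1) ↔ R i j := by
    intro i j
    rw [Finset.lt_sup_iff]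
    constructor
    · rintro ⟨k, -, hk⟩
      split_ifs at hk with h
      · obtain ⟨j', hj', hR⟩ := h
        obtain rfl : j' = j := Fin.ext (by omega)
        exact hup hR (Fin.le_def.2 (by omega))
      · omega
    · intro hR
      exact ⟨i, Finset.mem_univ _, by rw [if_pos ⟨j, rfl, hR⟩]; omega⟩
  have hgle : ∀ m B : ℕ, (∀ i j : Fin (n + 1), (j : ℕ) + 1 = m → R i j → (i : ℕ) < B) →
      g m ≤ B := by
    intro m B h
    refine Finset.sup_le fun i _ => ?_
    split_ifs with h'
    · obtain ⟨j, hj, hR⟩ := h'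
      exact h i j hj hR
    · exact Nat.zero_le _
  have hg : g ∈ boundedSeqs (n + 1) (n + 1) := by
    refine mem_boundedSeqs.2 ⟨fun m hm => ?_, fun m hm => ?_, fun m m' hmm hm' => ?_, ?_⟩
    · exact Nat.le_zero.1 (hgle m 0 fun i j hj _ => by omega)
    · refine hgle m _ fun i j hj hR => ?_
      have : (i : ℕ) < j := hlt hR
      omega
    · refine hgle m _ fun i j hj hR => ?_
      -- Sequence indices are column indices plus one; `m' ≥ m = j + 1` makes `m' - 1` a column not
      -- to the left of `j`.
      have := (hgR i ⟨m' - 1, by omega⟩).2 (hright hR (Fin.le_def.2 (by simp only; omega)))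
      simp only at this
      rwa [show m' - 1 + 1 = m' by omega] at this
    · exact hgle _ _ fun i j _ _ => i.2
  refine ⟨g, hg, le_antisymm (fun x hx i j h => ?_) fun x hx => ?_⟩
  · by_contra hne
    have := (hgR i j).2 ⟨x, hx, hne⟩
    omega
  · choose e he using fun (i j : Fin (n + 1)) (h : i < j) => hc.exists_single h
    have hx0 : ∀ i j, ¬ i < j → c x i j = 0 := by
      intro i j hij
      rcases (not_lt.1 hij).lt_or_eq with h | rfl
      · exact hc.upper x i j h
      · exact apply_diag_eq_zero hc hg hx _
    have key : x = ∑ i, ∑ j, if h : i < j then c x i j • e i j h else 0 := by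
      apply hc.inj
      rw [map_sum]
      nth_rewrite 1 [Matrix.matrix_eq_sum_single (c x)]
      refine Finset.sum_congr rfl fun i _ => ?_
      rw [map_sum]
      refine Finset.sum_congr rfl fun j _ => ?_
      split_ifs with h
      · rw [map_smul, he, Matrix.smul_single, smul_eq_mul, mul_one]
      · rw [hx0 i j h, Matrix.single_zero, map_zero]
    rw [key]
    refine sum_mem fun i _ => sum_mem fun j _ => ?_
    split_ifs with h
    · by_cases h0 : c x i j = 0
      · rw [h0, zero_smul]
        exact zero_mem _
      · refine I.smul_mem _ (hmem ?_ (he i j h))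
        rw [← hgR]
        by_contra hlt'
        exact h0 (hx i j (by omega))
    · exact zero_mem _

/-! ### Dimension and class of nilpotence of an ideal -/

theorem finrank_seqIdeal (hc : IsTriangularModel c) {g : ℕ → ℕ}
    (hg : g ∈ boundedSeqs (n + 1) (n + 1)) :
    Module.finrank ℂ (seqIdeal hc hg) = total (n + 1) g := by
  classical
  let S := {p : Fin (n + 1) × Fin (n + 1) // (p.1 : ℕ) < g (p.2 + 1)}
  let f : seqIdeal hc hg →ₗ[ℂ] (S → ℂ) :=
    { toFun := fun x p => c x p.1.1 p.1.2
      map_add' := fun x y => by ext p; simp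
      map_smul' := fun a x => by ext p; simp }
  have hf : Function.Bijective f := by
    constructor
    · rw [← LinearMap.ker_eq_bot, LinearMap.ker_eq_bot']
      intro x hx
      apply Subtype.ext
      apply hc.inj
      ext i j
      rw [ZeroMemClass.coe_zero, map_zero, Matrix.zero_apply]
      rcases Nat.lt_or_ge i (g (j + 1)) with h | h
      · exact congrFun hx ⟨(i, j), h⟩
      · exact x.2 i j h
    · intro a
      let A : Matrix (Fin (n + 1)) (Fin (n + 1)) ℂ := fun i j =>
        if h : (i : ℕ) < g (j + 1) then a ⟨(i, j), h⟩ else 0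
      have hA : ∀ i j : Fin (n + 1), g (j + 1) ≤ i → A i j = 0 := fun i j h =>
        dif_neg (by omega)
      have hle := seq_apply_le hg
      obtain ⟨x, hx⟩ := hc.surj A
        (fun i j h => hA i j ((hle j).trans h.le))
        (Finset.sum_eq_zero fun i _ => hA i i (hle i))
      refine ⟨⟨x, fun i j h => by rw [hx]; exact hA i j h⟩, ?_⟩
      funext p
      change c x p.1.1 p.1.2 = a p
      rw [hx]
      exact dif_pos p.2
  rw [(LinearEquiv.ofBijective f hf).finrank_eq, Module.finrank_fintype_fun_eq_card,
    Fintype.card_subtype, Finset.card_filter, Fintype.sum_prod_type_right, total,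
    Finset.sum_range_succ', boundedSeqs_apply_zero hg, add_zero,
    ← Fin.sum_univ_eq_sum_range (fun j => g (j + 1))]
  refine Finset.sum_congr rfl fun j _ => ?_
  have := seq_apply_le hg j
  rw [Fin.sum_univ_eq_sum_range (fun i => if i < g (j + 1) then 1 else 0) (n + 1),
    ← Finset.card_filter]
  rw [show {i ∈ Finset.range (n + 1) | i < g (j + 1)} = Finset.range (g (j + 1)) by
    ext i; simp; omega, Finset.card_range]

theorem iterate_mono {N : ℕ} {g : ℕ → ℕ} (hg : g ∈ boundedSeqs N N) (k : ℕ) {i j : ℕ}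
    (hij : i ≤ j) (hj : j ≤ N) : g^[k] i ≤ g^[k] j := by
  obtain ⟨-, h1, h2, -⟩ := mem_boundedSeqs.1 hg
  induction k with
  | zero => exact hij
  | succ k ih =>
    rw [Function.iterate_succ_apply', Function.iterate_succ_apply']
    have := iterate_add_le (fun l hl => h1 l (hl.trans hj)) k (g := g)
    exact h2 _ _ ih (by omega)

/-- Supports compose like the bounds: if `l < g (j + 1)` and `i < g^[k + 1] (l + 1)`, then `l + 1 ≤
g (j + 1)` and monotonicity give `i < g^[k + 2] (j + 1)`. The shift between rows counted from 0 and
sequence indices counted from 1 is what makes strict inequalities chain. -/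
theorem apply_eq_zero_of_mem_lowerCentralSeries (hc : IsTriangularModel c) {g : ℕ → ℕ}
    (hg : g ∈ boundedSeqs (n + 1) (n + 1)) (k : ℕ) :
    ∀ x ∈ LieModule.lowerCentralSeries ℂ (seqIdeal hc hg) (seqIdeal hc hg) k,
      ∀ i j : Fin (n + 1), g^[k + 1] (j + 1) ≤ i → c x i j = 0 := by
  obtain ⟨-, h1, h2, -⟩ := mem_boundedSeqs.1 hg
  induction k with
  | zero => exact fun x _ => x.2
  | succ k ih =>
    intro x hx i j hij
    rw [LieModule.lowerCentralSeries_succ, ← LieSubmodule.mem_toSubmodule,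
      LieSubmodule.lieIdeal_oper_eq_linear_span'] at hx
    induction hx using Submodule.span_induction with
    | zero => simp
    | add x y _ _ hx hy => simp [hx, hy]
    | smul a x _ hx => simp [hx]
    | mem z hz =>
      obtain ⟨y, -, x, hx, rfl⟩ := hz
      have e : c (⁅y, x⁆ : seqIdeal hc hg) = c y * c x - c x * c y := hc.lie y x
      rw [e, Matrix.sub_apply, Matrix.mul_apply,
        Matrix.mul_apply, Finset.sum_eq_zero, Finset.sum_eq_zero, sub_zero]
      · intro l _
        rcases Nat.lt_or_ge l (g (j + 1)) with h | h
        · have h3 := h1 (j + 1) (by omega)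
          have := iterate_mono hg (k + 1) (Nat.succ_le_of_lt h) (by omega)
          rw [← Function.iterate_succ_apply] at this
          rw [ih x hx i l (this.trans hij), zero_mul]
        · rw [y.2 l j h, mul_zero]
      · intro l _
        rcases Nat.lt_or_ge l (g^[k + 1] (j + 1)) with h | h
        · have h3 := iterate_add_le (fun m hm => h1 m (by omega)) (k + 1) (g := g)
            (N := j + 1)
          have := h2 _ _ (Nat.succ_le_of_lt h) (by omega)
          rw [← Function.iterate_succ_apply' g] at this
          rw [y.2 i l (this.trans hij), zero_mul]
        · rw [ih x hx l j h, mul_zero]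

theorem mem_lowerCentralSeries_of_single (hc : IsTriangularModel c) {g : ℕ → ℕ}
    (hg : g ∈ boundedSeqs (n + 1) (n + 1)) (k : ℕ) :
    ∀ (x : seqIdeal hc hg) (i j : Fin (n + 1)), (i : ℕ) < g^[k + 1] (j + 1) →
      c x = Matrix.single i j 1 →
      x ∈ LieModule.lowerCentralSeries ℂ (seqIdeal hc hg) (seqIdeal hc hg) k := by
  induction k with
  | zero => exact fun x _ _ _ _ => LieSubmodule.mem_top x
  | succ k ih =>
    intro x i j hij hx
    rw [Function.iterate_succ_apply'] at hij
    have h1 := (mem_boundedSeqs.1 hg).2.1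
    have h3 := iterate_add_le (fun m hm => h1 m (by omega)) (k + 1) (g := g) (N := j + 1)
    have h0 : g^[k + 1] (j + 1) ≠ 0 := by
      intro h
      rw [h, boundedSeqs_apply_zero hg] at hij
      omega
    -- The pivot `l` is the last row allowed by `g^[k + 1]` in column `j`; then `E_{ij} = [E_{il},
    -- E_{lj}]` with `E_{il}` in the ideal and `E_{lj}` in the previous term of the series.
    obtain ⟨l, hl⟩ := Nat.exists_eq_succ_of_ne_zero h0
    have hlj : l < j := by omega
    rw [hl] at hij
    let l' : Fin (n + 1) := ⟨l, by omega⟩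
    have hil : i < l' := Fin.lt_def.2 (lt_of_lt_of_le hij (seq_apply_le hg l'))
    have hlj' : l' < j := Fin.lt_def.2 hlj
    obtain ⟨y, hy⟩ := hc.exists_single hil
    obtain ⟨z, hz⟩ := hc.exists_single hlj'
    have hyI : y ∈ seqIdeal hc hg := (single_mem_seqIdeal hc hg hy).2 hij
    have hl1 : (l' : ℕ) < g^[k + 1] (j + 1) := by rw [hl]; exact Nat.lt_succ_self l
    have hzI : z ∈ seqIdeal hc hg := by
      refine (single_mem_seqIdeal hc hg hz).2 (lt_of_lt_of_le hl1 ?_)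
      rw [Function.iterate_succ_apply]
      have h4 := h1 (j + 1) (by omega)
      exact (iterate_add_le (fun m hm => h1 m (by omega)) k (g := g)).trans (Nat.sub_le _ _)
    have : x = ⁅(⟨y, hyI⟩ : seqIdeal hc hg), (⟨z, hzI⟩ : seqIdeal hc hg)⁆ := by
      apply Subtype.ext
      apply hc.inj
      rw [hx]
      exact (hc.lie_single (hil.trans hlj').ne hy hz).symm
    rw [this, LieModule.lowerCentralSeries_succ]
    exact LieSubmodule.lie_mem_lie (LieSubmodule.mem_top _) (ih ⟨z, hzI⟩ l' j hl1 hz)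

/-- The top right corner is the last position to disappear, so only the iterate at `n + 1` matters.
-/
theorem lowerCentralSeries_eq_bot_iff (hc : IsTriangularModel c) {g : ℕ → ℕ}
    (hg : g ∈ boundedSeqs (n + 1) (n + 1)) (k : ℕ) :
    LieModule.lowerCentralSeries ℂ (seqIdeal hc hg) (seqIdeal hc hg) k = ⊥ ↔
      g^[k + 1] (n + 1) = 0 := by
  constructor
  · intro h
    by_contra hne
    have h1 := iterate_add_le (mem_boundedSeqs.1 hg).2.1 (k + 1)
    have h2 := iterate_add_le (mem_boundedSeqs.1 hg).2.1 k
    have hlt : (0 : Fin (n + 1)) < Fin.last n := by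
      rw [Fin.lt_def, Fin.val_last, Fin.val_zero]
      omega
    obtain ⟨x, hx⟩ := hc.exists_single hlt
    have hgn : 0 < g (n + 1) := by
      rw [Function.iterate_succ_apply] at hne
      have := iterate_add_le (fun m hm => (mem_boundedSeqs.1 hg).2.1 m
        (hm.trans (mem_boundedSeqs.1 hg).2.2.2)) k (g := g) (N := g (n + 1))
      omega
    have hxI : x ∈ seqIdeal hc hg := (single_mem_seqIdeal hc hg hx).2 (by simpa using hgn)
    have := mem_lowerCentralSeries_of_single hc hg k ⟨x, hxI⟩ 0 (Fin.last n)
      (by rw [Fin.val_last, Fin.val_zero]; omega) hx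
    rw [h, LieSubmodule.mem_bot] at this
    have hx0 : x = 0 := congrArg Subtype.val this
    rw [hx0, map_zero] at hx
    have := congrFun (congrFun hx 0) (Fin.last n)
    rw [Matrix.single_apply_same] at this
    exact zero_ne_one this
  · intro h
    rw [LieSubmodule.eq_bot_iff]
    intro x hx
    apply Subtype.ext
    apply hc.inj
    ext i j
    rw [ZeroMemClass.coe_zero, map_zero, Matrix.zero_apply]
    refine apply_eq_zero_of_mem_lowerCentralSeries hc hg k x hx i j ?_
    have := iterate_mono hg (k + 1) (show (j : ℕ) + 1 ≤ n + 1 by omega) le_rfl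
    omega

theorem nilpotencyLength_seqIdeal (hc : IsTriangularModel c) {g : ℕ → ℕ}
    (hg : g ∈ boundedSeqs (n + 1) (n + 1)) :
    LieModule.nilpotencyLength (seqIdeal hc hg) (seqIdeal hc hg) = descents g (n + 1) := by
  rw [LieModule.nilpotencyLength, descents]
  congr 1
  ext k
  rw [Set.mem_ofPred_eq, Set.mem_ofPred_eq, ← lowerCentralSeries_eq_bot_iff hc hg]
  -- `LieModule.nilpotencyLength` uses the lower central series over `ℤ`, which has the same
  -- underlying sets as the one over `ℂ`.
  simp [SetLike.ext'_iff, LieModule.coe_lowerCentralSeries_eq_int ℂ]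

end

/-! ### Borel subalgebras of `sl(n+1, ℂ)` -/

/-- A common triangularization of a finite-dimensional module over a solvable Lie algebra. -/
theorem exists_triangular_basis (L : Type*) [LieRing L] [LieAlgebra ℂ L]
    [LieAlgebra.IsSolvable L] (d : ℕ) :
    ∀ (V : Type) [AddCommGroup V] [Module ℂ V] [LieRingModule L V] [LieModule ℂ L V]
      [Module.Finite ℂ V], Module.finrank ℂ V = d →
      ∃ v : Module.Basis (Fin d) ℂ V, ∀ (x : L) (i j : Fin d), j < i → v.repr ⁅x, v j⁆ i = 0 := by
  induction d with
  | zero =>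
    intro V _ _ _ _ _ hV
    exact ⟨Module.finBasisOfFinrankEq ℂ V hV, fun x i => i.elim0⟩
  | succ d ih =>
    intro V _ _ _ _ _ hV
    have : Nontrivial V := Module.nontrivial_of_finrank_pos (R := ℂ) (by omega)
    -- Lie's theorem supplies a common eigenvector; it becomes the first basis vector, followed by
    -- lifts of a triangular basis of the quotient by its span.
    obtain ⟨χ, hχ⟩ := LieModule.exists_nontrivial_weightSpace_of_isSolvable ℂ L V
    obtain ⟨⟨v, hv⟩, hv0⟩ := exists_ne (0 : LieModule.weightSpace V χ)
    rw [LieModule.mem_weightSpace] at hv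
    have hv0 : v ≠ 0 := fun h => hv0 (Subtype.ext h)
    let W : LieSubmodule ℂ L V :=
      { Submodule.span ℂ {v} with
        lie_mem := fun {x w} hw => by
          obtain ⟨a, rfl⟩ := Submodule.mem_span_singleton.1 hw
          rw [lie_smul, hv]
          exact Submodule.smul_mem _ _ (Submodule.smul_mem _ _
            (Submodule.mem_span_singleton_self v)) }
    have hW : Module.finrank ℂ W.toSubmodule = 1 := finrank_span_singleton hv0
    have hQ : Module.finrank ℂ (V ⧸ W) = d := by
      have := Submodule.finrank_quotient_add_finrank W.toSubmodule
      rw [hW, hV] at this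
      exact Nat.succ_injective this
    obtain ⟨q, hq⟩ := ih (V ⧸ W) hQ
    let w : Module.Basis (Fin 1) ℂ W.toSubmodule := Module.finBasisOfFinrankEq ℂ _ hW
    let u : Module.Basis (Fin 1 ⊕ Fin d) ℂ V := Module.Basis.sumQuot w q
    let e : Fin 1 ⊕ Fin d ≃ Fin (d + 1) := finSumFinEquiv.trans (finCongr (Nat.add_comm 1 d))
    refine ⟨u.reindex e, fun x i j hij => ?_⟩
    obtain ⟨i, rfl⟩ := e.surjective i
    obtain ⟨j, rfl⟩ := e.surjective j
    rw [Module.Basis.repr_reindex_apply, Module.Basis.reindex_apply, Equiv.symm_apply_apply,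
      Equiv.symm_apply_apply]
    rcases i with i | i
    · have : ((e (Sum.inl i) : Fin (d + 1)) : ℕ) = 0 := by
        simp [e]
      rw [Fin.lt_def, this] at hij
      omega
    · have h1 : ∀ y : V, u.repr y (Sum.inr i) = q.repr (W.toSubmodule.mkQ y) i := fun y =>
        Module.Basis.sumQuot_repr_inr w q y i
      rw [h1]
      rcases j with j | j
      · have h2 : ⁅x, u (Sum.inl j)⁆ ∈ W := by
          refine W.lie_mem ?_
          rw [show u (Sum.inl j) = w j from Module.Basis.sumQuot_inl w q j]
          exact (w j).2
        rw [Submodule.mkQ_apply, (Submodule.Quotient.mk_eq_zero _).2 h2, map_zero]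
        rfl
      · have h2 : W.toSubmodule.mkQ ⁅x, u (Sum.inr j)⁆ = ⁅x, q j⁆ := by
          rw [← Module.Basis.sumQuot_inr w q j]
          rfl
        rw [h2]
        refine hq x i j ?_
        rw [Fin.lt_def] at hij ⊢
        simpa [e] using hij

theorem map_sl_lie {n : ℕ}
    {φ : Matrix (Fin (n + 1)) (Fin (n + 1)) ℂ ≃ₐ[ℂ] Matrix (Fin (n + 1)) (Fin (n + 1)) ℂ}
    (x y : SL n) : φ (⁅x, y⁆ : SL n).1 = φ x.1 * φ y.1 - φ y.1 * φ x.1 := by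
  rw [LieAlgebra.SpecialLinear.sl_bracket, map_sub, map_mul, map_mul]

/-- The traceless matrices that become upper triangular under an automorphism `φ`. -/
def triangularSubalgebra {n : ℕ}
    (φ : Matrix (Fin (n + 1)) (Fin (n + 1)) ℂ ≃ₐ[ℂ] Matrix (Fin (n + 1)) (Fin (n + 1)) ℂ) :
    LieSubalgebra ℂ (SL n) where
  carrier := {x | ∀ i j, j < i → φ x.1 i j = 0}
  zero_mem' := fun i j _ => by simp
  add_mem' := fun {x y} hx hy i j h => by
    have : φ (x + y).1 = φ x.1 + φ y.1 := map_add φ x.1 y.1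
    rw [this, Matrix.add_apply, hx i j h, hy i j h, add_zero]
  smul_mem' := fun a x hx i j h => by
    have : φ (a • x).1 = a • φ x.1 := map_smul φ a x.1
    rw [this, Matrix.smul_apply, hx i j h, smul_zero]
  lie_mem' := fun {x y} hx hy i j h => by
    rw [map_sl_lie, Matrix.sub_apply, Matrix.mul_apply, Matrix.mul_apply, Finset.sum_eq_zero,
      Finset.sum_eq_zero, sub_zero]
    · intro l _
      rcases lt_or_ge l i with hl | hl
      · rw [hy i l hl, zero_mul]
      · rw [hx l j (h.trans_le hl), mul_zero]
    · intro l _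
      rcases lt_or_ge l i with hl | hl
      · rw [hx i l hl, zero_mul]
      · rw [hy l j (h.trans_le hl), mul_zero]

section

variable {n : ℕ}
  {φ : Matrix (Fin (n + 1)) (Fin (n + 1)) ℂ ≃ₐ[ℂ] Matrix (Fin (n + 1)) (Fin (n + 1)) ℂ}

theorem mul_apply_eq_zero {A B : Matrix (Fin (n + 1)) (Fin (n + 1)) ℂ} {k l : ℕ}
    (hA : ∀ i j : Fin (n + 1), (j : ℕ) < i + k → A i j = 0)
    (hB : ∀ i j : Fin (n + 1), (j : ℕ) < i + l → B i j = 0) (i j : Fin (n + 1))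
    (h : (j : ℕ) < i + (k + l)) : (A * B) i j = 0 := by
  rw [Matrix.mul_apply]
  refine Finset.sum_eq_zero fun m _ => ?_
  rcases Nat.lt_or_ge m (i + k) with hm | hm
  · rw [hA i m hm, zero_mul]
  · rw [hB m j (by omega), mul_zero]

theorem upper_mul_apply_self {A B : Matrix (Fin (n + 1)) (Fin (n + 1)) ℂ}
    (hA : ∀ i j : Fin (n + 1), j < i → A i j = 0)
    (hB : ∀ i j : Fin (n + 1), j < i → B i j = 0) (i : Fin (n + 1)) :
    (A * B) i i = A i i * B i i := by
  rw [Matrix.mul_apply, Finset.sum_eq_single i]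
  · intro m _ hm
    rcases lt_or_gt_of_ne hm with h | h
    · rw [hA i m h, zero_mul]
    · rw [hB m i h, mul_zero]
  · simp

theorem apply_eq_zero_of_mem_derivedSeries (k : ℕ) :
    ∀ x ∈ LieAlgebra.derivedSeries ℂ (triangularSubalgebra φ) k,
      ∀ i j : Fin (n + 1), (j : ℕ) < i + k → φ x.1.1 i j = 0 := by
  induction k with
  | zero => exact fun x _ i j h => x.2 i j (by simpa using h)
  | succ k ih =>
    intro x hx i j hij
    rw [LieAlgebra.derivedSeries_def, LieAlgebra.derivedSeriesOfIdeal_succ,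
      ← LieSubmodule.mem_toSubmodule, LieSubmodule.lieIdeal_oper_eq_linear_span'] at hx
    induction hx using Submodule.span_induction with
    | zero => simp
    | add x y _ _ hx hy =>
      have : φ (x + y).1.1 = φ x.1.1 + φ y.1.1 := map_add φ x.1.1 y.1.1
      rw [this, Matrix.add_apply, hx, hy, add_zero]
    | smul a x _ hx =>
      have : φ (a • x).1.1 = a • φ x.1.1 := map_smul φ a x.1.1
      rw [this, Matrix.smul_apply, hx, smul_zero]
    | mem z hz =>
      obtain ⟨x, hx, y, hy, rfl⟩ := hz
      have e : φ (⁅x, y⁆ : triangularSubalgebra φ).1.1 = φ x.1.1 * φ y.1.1 - φ y.1.1 * φ x.1.1 :=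
        map_sl_lie x.1 y.1
      rw [e, Matrix.sub_apply]
      -- A product of two matrices supported on `j ≥ i + k` is supported on `j ≥ i + 2k`, and `2k ≥
      -- k + 1` unless `k = 0`. In that case the diagonals of the two products agree and cancel in
      -- the commutator.
      rcases Nat.eq_zero_or_pos k with rfl | hk
      · rcases Nat.lt_or_ge j i with h | h
        · rw [mul_apply_eq_zero (ih x hx) (ih y hy) i j (by omega),
            mul_apply_eq_zero (ih y hy) (ih x hx) i j (by omega), sub_zero]
        · obtain rfl : i = j := Fin.ext (by omega)
          rw [upper_mul_apply_self x.2 y.2, upper_mul_apply_self y.2 x.2, mul_comm, sub_self]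
      · rw [mul_apply_eq_zero (ih x hx) (ih y hy) i j (by omega),
          mul_apply_eq_zero (ih y hy) (ih x hx) i j (by omega), sub_zero]

theorem isSolvable_triangularSubalgebra : LieAlgebra.IsSolvable (triangularSubalgebra φ) := by
  refine LieAlgebra.IsSolvable.mk (R := ℂ) (k := n + 1) ?_
  rw [LieSubmodule.eq_bot_iff]
  intro x hx
  apply Subtype.ext
  apply Subtype.ext
  apply φ.injective
  ext i j
  rw [apply_eq_zero_of_mem_derivedSeries _ x hx i j (by omega)]
  simp

theorem exists_triangularSubalgebra_eq {b : LieSubalgebra ℂ (SL n)} (hb : IsBorel b) :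
    ∃ φ : Matrix (Fin (n + 1)) (Fin (n + 1)) ℂ ≃ₐ[ℂ] Matrix (Fin (n + 1)) (Fin (n + 1)) ℂ,
      (∀ A, (φ A).trace = A.trace) ∧ b = triangularSubalgebra φ := by
  have : LieAlgebra.IsSolvable b := hb.1
  let f : b →ₗ⁅ℂ⁆ Module.End ℂ (Fin (n + 1) → ℂ) :=
    { toFun := fun x => Matrix.toLin' x.1.1
      map_add' := fun x y => map_add Matrix.toLin' x.1.1 y.1.1
      map_smul' := fun a x => map_smul Matrix.toLin' a x.1.1
      map_lie' := fun {x y} => by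
        change Matrix.toLin' (x.1.1 * y.1.1 - y.1.1 * x.1.1) = _
        rw [map_sub, Matrix.toLin'_mul, Matrix.toLin'_mul]
        rfl }
  let : LieRingModule b (Fin (n + 1) → ℂ) := LieRingModule.compLieHom _ f
  have : LieModule ℂ b (Fin (n + 1) → ℂ) := LieModule.compLieHom _ f
  obtain ⟨v, hv⟩ := exists_triangular_basis b (n + 1) (Fin (n + 1) → ℂ) (by simp)
  let φ : Matrix (Fin (n + 1)) (Fin (n + 1)) ℂ ≃ₐ[ℂ] Matrix (Fin (n + 1)) (Fin (n + 1)) ℂ :=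
    Matrix.toLinAlgEquiv'.trans (LinearMap.toMatrixAlgEquiv v)
  have hφ : ∀ A, φ A = LinearMap.toMatrix v v (Matrix.toLin' A) := fun A => rfl
  have hle : b ≤ triangularSubalgebra φ := by
    intro x hx i j hij
    rw [hφ, LinearMap.toMatrix_apply]
    exact hv ⟨x, hx⟩ i j hij
  -- The triangular subalgebra is solvable and contains `b`, so maximality of `b` forces equality.
  refine ⟨φ, fun A => ?_, le_antisymm hle (hb.2 isSolvable_triangularSubalgebra hle)⟩
  rw [hφ, ← LinearMap.trace_eq_matrix_trace, Matrix.trace_toLin'_eq]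

/-- The matrix of an element of the triangular subalgebra. -/
def triangularModel
    (φ : Matrix (Fin (n + 1)) (Fin (n + 1)) ℂ ≃ₐ[ℂ] Matrix (Fin (n + 1)) (Fin (n + 1)) ℂ) :
    triangularSubalgebra φ →ₗ[ℂ] Matrix (Fin (n + 1)) (Fin (n + 1)) ℂ where
  toFun x := φ x.1.1
  map_add' x y := map_add φ x.1.1 y.1.1
  map_smul' a x := map_smul φ a x.1.1

theorem exists_sl_eq (hφ : ∀ A, (φ A).trace = A.trace)
    {A : Matrix (Fin (n + 1)) (Fin (n + 1)) ℂ} (hA : A.trace = 0) : ∃ x : SL n, φ x.1 = A := by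
  refine ⟨⟨φ.symm A, ?_⟩, φ.apply_symm_apply A⟩
  have : (φ.symm A).trace = 0 := by rw [← hφ, φ.apply_symm_apply, hA]
  exact this

theorem isTriangularModel (hφ : ∀ A, (φ A).trace = A.trace) :
    IsTriangularModel (triangularModel φ) where
  inj x y h := Subtype.ext (Subtype.ext (φ.injective h))
  lie x y := map_sl_lie x.1 y.1
  upper x := x.2
  surj A hA hA' := by
    obtain ⟨x, hx⟩ := exists_sl_eq hφ hA'
    exact ⟨⟨x, fun i j h => by rw [hx]; exact hA i j h⟩, hx⟩

/-! ### Ad-nilpotent elements and vanishing diagonals -/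

theorem pow_apply_eq_zero {A : Matrix (Fin (n + 1)) (Fin (n + 1)) ℂ}
    (hA : ∀ i j : Fin (n + 1), j ≤ i → A i j = 0) (k : ℕ) :
    ∀ i j : Fin (n + 1), (j : ℕ) < i + k → (A ^ k) i j = 0 := by
  induction k with
  | zero =>
    intro i j h
    rw [pow_zero, Matrix.one_apply_ne (by rintro rfl; omega)]
  | succ k ih =>
    intro i j h
    rw [pow_succ]
    exact mul_apply_eq_zero ih (fun i j h => hA i j (Fin.le_def.2 (by omega))) i j h

theorem isNilpotent_ad_of_diag_eq_zero {x : SL n} (hx : x ∈ triangularSubalgebra φ)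
    (hdiag : ∀ i, φ x.1 i i = 0) : IsNilpotent (LieAlgebra.ad ℂ (SL n) x) := by
  refine LieAlgebra.isNilpotent_ad_of_isNilpotent (L := LieAlgebra.SpecialLinear.sl (Fin (n + 1)) ℂ) ?_
  refine ⟨n + 1, φ.injective ?_⟩
  rw [map_pow, map_zero]
  ext i j
  refine pow_apply_eq_zero (fun i j h => ?_) _ i j (by omega)
  rcases h.lt_or_eq with h | rfl
  · exact hx i j h
  · exact hdiag _

/-- The entry `(i, j)` of the iterated brackets of a triangular matrix with a matrix unit. -/
theorem ad_pow_apply {x y : SL n} (hx : x ∈ triangularSubalgebra φ) {i j : Fin (n + 1)}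
    (hy : φ y.1 = Matrix.single i j 1) (m : ℕ) :
    (∀ k l, i < k ∨ l < j → φ (((LieAlgebra.ad ℂ (SL n) x) ^ m) y).1 k l = 0) ∧
      φ (((LieAlgebra.ad ℂ (SL n) x) ^ m) y).1 i j = (φ x.1 i i - φ x.1 j j) ^ m := by
  induction m with
  | zero =>
    refine ⟨fun k l h => ?_, ?_⟩
    · rw [pow_zero, Module.End.one_apply, hy, Matrix.single_apply, if_neg]
      rintro ⟨rfl, rfl⟩
      rcases h with h | h <;> exact h.false
    · rw [pow_zero, Module.End.one_apply, hy, Matrix.single_apply_same, pow_zero]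
  | succ m ih =>
    obtain ⟨h1, h2⟩ := ih
    rw [pow_succ', Module.End.mul_apply, LieAlgebra.ad_apply, map_sl_lie]
    generalize ((LieAlgebra.ad ℂ (SL n) x) ^ m) y = z at h1 h2
    refine ⟨fun k l h => ?_, ?_⟩
    · rw [Matrix.sub_apply, Matrix.mul_apply, Matrix.mul_apply, Finset.sum_eq_zero,
        Finset.sum_eq_zero, sub_zero]
      · intro r _
        rcases lt_or_ge l r with hr | hr
        · rw [hx r l hr, mul_zero]
        · rw [h1 k r (h.imp_right hr.trans_lt), zero_mul]
      · intro r _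
        rcases lt_or_ge r k with hr | hr
        · rw [hx k r hr, zero_mul]
        · rw [h1 r l (h.imp_left fun h => h.trans_le hr), mul_zero]
    · rw [Matrix.sub_apply, Matrix.mul_apply, Matrix.mul_apply, Finset.sum_eq_single i,
        Finset.sum_eq_single j, h2]
      · ring
      · intro r _ hr
        rcases lt_or_gt_of_ne hr with hr | hr
        · rw [h1 i r (Or.inr hr), zero_mul]
        · rw [hx r j hr, mul_zero]
      · simp
      · intro r _ hr
        rcases lt_or_gt_of_ne hr with hr | hr
        · rw [hx i r hr, zero_mul]
        · rw [h1 r j (Or.inl hr), mul_zero]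
      · simp

/-- By `ad_pow_apply`, nilpotency of `ad x` kills a power of every difference of diagonal entries,
so the diagonal is constant; as the trace is zero, that constant is zero. -/
theorem diag_eq_zero_of_isNilpotent_ad (hφ : ∀ A, (φ A).trace = A.trace) {x : SL n}
    (hx : x ∈ triangularSubalgebra φ) (h : IsNilpotent (LieAlgebra.ad ℂ (SL n) x))
    (i : Fin (n + 1)) : φ x.1 i i = 0 := by
  obtain ⟨m, hm⟩ := h
  have heq : ∀ j, φ x.1 j j = φ x.1 i i := by
    intro j
    by_cases hij : j = i
    · rw [hij]
    · obtain ⟨y, hy⟩ := exists_sl_eq hφ (Matrix.trace_single_eq_of_ne j i (1 : ℂ) hij)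
      have := (ad_pow_apply hx hy m).2
      rw [hm] at this
      have h0 : φ ((0 : Module.End ℂ (SL n)) y).1 = 0 := map_zero φ
      rw [h0, Matrix.zero_apply] at this
      exact sub_eq_zero.1 (eq_zero_of_pow_eq_zero this.symm)
  have htr : (φ x.1).trace = 0 := (hφ _).trans x.2
  simp only [Matrix.trace, Matrix.diag_apply, heq] at htr
  rw [Finset.sum_const, Finset.card_univ,
    Fintype.card_fin, smul_eq_zero] at htr
  exact htr.resolve_left (by omega)

end

/-! ### Passage from ideals to sequences -/

/-- The ad-nilpotent ideals of a Borel subalgebra, parametrized by sequences. -/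
theorem exists_ideal_parametrization {n : ℕ} {b : LieSubalgebra ℂ (SL n)} (hb : IsBorel b) :
    ∃ F : boundedSeqs (n + 1) (n + 1) → LieIdeal ℂ b, Function.Injective F ∧
      Set.range F = adNilpotentIdeals b ∧ ∀ g,
      Module.finrank ℂ (F g) = total (n + 1) g.1 ∧
      nilpotenceClass (F g) = descents g.1 (n + 1) := by
  obtain ⟨φ, hφ, rfl⟩ := exists_triangularSubalgebra_eq hb
  have hc := isTriangularModel hφ
  refine ⟨fun g => seqIdeal hc g.2, fun g g' h => Subtype.ext (seqIdeal_injective hc _ _ h), ?_,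
    fun g => ⟨finrank_seqIdeal hc g.2, nilpotencyLength_seqIdeal hc g.2⟩⟩
  ext I
  constructor
  · rintro ⟨g, rfl⟩ x hx
    exact isNilpotent_ad_of_diag_eq_zero x.2 (apply_diag_eq_zero hc g.2 hx)
  · intro hI
    obtain ⟨g, hg, rfl⟩ := hc.exists_eq_seqIdeal I fun x hx =>
      diag_eq_zero_of_isNilpotent_ad hφ x.2 (hI x hx)
    exact ⟨⟨g, hg⟩, rfl⟩

theorem qtCatalan_eq {n : ℕ} {b : LieSubalgebra ℂ (SL n)}
    {F : boundedSeqs (n + 1) (n + 1) → LieIdeal ℂ b} (hinj : Function.Injective F)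
    (hrange : Set.range F = adNilpotentIdeals b)
    (hF : ∀ g, Module.finrank ℂ (F g) = total (n + 1) g.1 ∧
      nilpotenceClass (F g) = descents g.1 (n + 1)) :
    qtCatalan b = ∑ g ∈ boundedSeqs (n + 1) (n + 1),
      (C (X ^ total (n + 1) g) * X ^ descents g (n + 1) : ℤ[X][X]) := by
  classical
  let stat : (ℕ → ℕ) → ℕ × ℕ := fun g => (total (n + 1) g, descents g (n + 1))
  have hcount : ∀ p : ℕ × ℕ, idealCount b p.1 p.2 =
      Finset.card {g ∈ boundedSeqs (n + 1) (n + 1) | stat g = p} := by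
    intro p
    have : {I | I ∈ adNilpotentIdeals b ∧ Module.finrank ℂ I = p.1 ∧ nilpotenceClass I = p.2} =
        F '' {g | stat g.1 = p} := by
      ext I
      rw [← hrange]
      constructor
      · rintro ⟨⟨g, rfl⟩, h1, h2⟩
        exact ⟨g, Prod.ext ((hF g).1.symm.trans h1) ((hF g).2.symm.trans h2), rfl⟩
      · rintro ⟨g, hg, rfl⟩
        exact ⟨⟨g, rfl⟩, (hF g).1.trans (congrArg Prod.fst hg),
          (hF g).2.trans (congrArg Prod.snd hg)⟩
    rw [idealCount, this, Set.ncard_image_of_injective _ hinj,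
      ← Set.ncard_image_of_injective _ Subtype.val_injective, ← Set.ncard_coe_finset]
    congr 1
    ext g
    simp [and_comm]
  rw [qtCatalan, finsum_eq_sum_of_support_subset
    (s := (boundedSeqs (n + 1) (n + 1)).image stat)]
  -- The sum over sequences is grouped by the pair (sum of terms, number of descents); each fibre
  -- has `idealCount` elements.
  · rw [← Finset.sum_fiberwise_of_maps_to (g := stat)
      fun g hg => Finset.mem_image_of_mem stat hg]
    refine Finset.sum_congr rfl fun p _ => ?_
    rw [Finset.sum_congr rfl fun g hg => by
      rw [show total (n + 1) g = p.1 from congrArg Prod.fst (Finset.mem_filter.1 hg).2,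
        show descents g (n + 1) = p.2 from congrArg Prod.snd (Finset.mem_filter.1 hg).2],
      Finset.sum_const, hcount, nsmul_eq_mul, mul_assoc]
  · intro p hp
    rw [Function.mem_support] at hp
    by_contra hnot
    apply hp
    rw [hcount, Finset.card_eq_zero.2, Nat.cast_zero, zero_mul, zero_mul]
    refine Finset.filter_eq_empty_iff.2 fun g hg h => hnot ?_
    exact Finset.mem_coe.2 (Finset.mem_image.2 ⟨g, hg, h⟩)

end QTCatalan

theorem theorem6p1 (n : ℕ) (b : LieSubalgebra ℂ (QTCatalan.SL n)) (hb : QTCatalan.IsBorel b) :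
    (QTCatalan.adNilpotentIdeals b).Finite ∧
    QTCatalan.qtCatalan b =
      ∑ k ∈ Finset.range (n + 1),
        Polynomial.C (∑ i ∈ QTCatalan.indexSeqs n k, QTCatalan.seqWeight i) *
          Polynomial.X ^ k ∧
    Polynomial.X *
        (QTCatalan.qtCatalan b).map (Polynomial.evalRingHom (1 : ℤ)) =
      ∑ p : QTCatalan.DyckPath (n + 1), Polynomial.X ^ QTCatalan.height p.1 ∧
    ∃ w : QTCatalan.DyckPath (n + 1) → ℕ,
      (∀ p, (w p : ℚ) = ((n : ℚ) + 1) ^ 2 / 2 - QTCatalan.area p.1 / 2) ∧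
      (QTCatalan.qtCatalan b).eval 1 = ∑ p, (Polynomial.X : Polynomial ℤ) ^ w p := by
  obtain ⟨F, hinj, hrange, hF⟩ := QTCatalan.exists_ideal_parametrization hb
  have key := QTCatalan.qtCatalan_eq hinj hrange hF
  obtain ⟨w, hw, hsum⟩ := QTCatalan.exists_area_weight n
  refine ⟨hrange ▸ Set.finite_range F,
    key.trans (QTCatalan.sum_boundedSeqs_eq_sum_indexSeqs n), ?_, w, hw, ?_⟩
  · rw [key, QTCatalan.sum_boundedSeqs_eq, QTCatalan.X_mul_sum_seqGF]
  · rw [key, ← hsum, Polynomial.eval_finsetSum]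
    simp
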